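/- Let $\mathcal X$ be a finite non-empty set, let $r(x,y)\ge 0$ ($x,y\in\mathcal X$) be transition rates which are irreducible (any state can be reached from any other one via jumps of positive rate), let $T>0$, $\omega=2\pi/T$, and let $g:\mathbb R\times\mathcal X\times\mathcal X\to\mathbb R$ be bounded, measurable and $T$-periodic in its first argument. For $\lambda\in\mathbb R$ let $(X^\lambda_t)_{t\ge0}$ be the (time-inhomogeneous) Markov jump process on $\mathcal X$ with transition rates $r^\lambda(s,x,y)=e^{\lambda g(s,x,y)}r(x,y)$, and let $X=X^0$ be the unperturbed process; $\mathbb P_x$ is the law of the process started at $x$, and $\mathbb P_\nu=\sum_x\nu(x)\mathbb P_x$ for a probability distribution $\nu$. Then: (i) $X$ has a unique invariant distribution $\pi$, and for every $\lambda$ the discrete-time chain $(X^\lambda_{nT})_{n\ge 0}$ has a unique invariant distribution $\pi_\lambda$ (the law of $X^\lambda$ with initial distribution $\pi_\lambda$ is called the oscillatory steady state, OSS). (ii) For $v:\mathcal X\to\mathbb R$ the function $f_\lambda(t):=\mathbb E_{\pi_\lambda}[v(X^\lambda_t)]$, $t\ge0$, is $T$-periodic, i.e. $f_\lambda(t+T)=f_\lambda(t)$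 for all $t\ge0$, and it is integrable on $[0,T]$. (iii) For an integrable function $f$ on $[0,T]$ write $c_k(f)=\frac1T\int_0^T e^{-ik\omega t}f(t)\,dt$, $k\in\mathbb Z$. Let $\mathcal Lf(x)=\sum_y r(x,y)[f(y)-f(x)]$, $\langle f,h\rangle=\sum_x\pi(x)\overline{f(x)}h(x)$, $r^*(x,y)=\pi(y)r(y,x)/\pi(x)$, $$\psi_t(x)=\sum_{y}\bigl(r^*(x,y)\,g(t,y,x)-r(x,y)\,g(t,x,y)\bigr),\qquad \hat\psi_k(x)=c_k\bigl(t\mapsto\psi_t(x)\bigr).$$ Then for every $v:\mathcal X\to\mathbb R$ and every $k\in\mathbb Z$ the map $\lambda\mapsto c_k(f_\lambda)$ is differentiable at $\lambda=0$, the integrals below converge absolutely, and $$\partial_{\lambda=0}\,c_k(f_\lambda)=\int_0^\infty\bigl\langle e^{s(\mathcal L+ik\omega)}v,\hat\psi_k\bigr\rangle\,ds=\int_0^\infty e^{-ik\omega s}\,\mathbb E_\pi\bigl[v(X_s)\hat\psi_k(X_0)\bigr]\,ds .$$ -/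

import Mathlib

open MeasureTheory ProbabilityTheory Filter Topology
open scoped NNReal ENNReal BigOperators

namespace JumpLR

noncomputable section

/-- The generator associated with transition rates `q`, acting on real functions:
`L f (x) = ∑ y, q x y * (f y - f x)`. -/
def jumpGenerator {S : Type*} [Fintype S] (q : S → S → ℝ) (f : S → ℝ) (x : S) : ℝ :=
  ∑ y, q x y * (f y - f x)

/-- The Markov jump process with (possibly time-dependent) transition rates `R s x y`, started
at `x₀`, on the finite state space `S`: under the probability measure `P` the process `X` has
càdlàg paths (for the discrete topology of `S`), starts from `x₀` and solves the martingale
problem for the time-dependent generator `L_s f (x) = ∑ y, R s x y * (f y - f x)`.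
The filtration may be any one to which `X` is adapted; by the tower property this is the same as
asking for the natural filtration of `X`. -/
structure IsMarkovJumpProcess {S : Type*} [Fintype S] [MeasurableSpace S]
    (R : ℝ → S → S → ℝ) (x₀ : S)
    {Ω : Type*} [mΩ : MeasurableSpace Ω] (P : Measure Ω) (X : ℝ≥0 → Ω → S) : Prop where
  isProbabilityMeasure : IsProbabilityMeasure P
  measurable : ∀ t, Measurable (X t)
  rightContinuous : ∀ ω t, ∀ᶠ s in 𝓝[≥] t, X s ω = X t ω
  leftLimits : ∀ ω t, ∃ y, ∀ᶠ s in 𝓝[<] t, X s ω = y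
  start : ∀ᵐ ω ∂P, X 0 ω = x₀
  martingaleProblem : ∃ ℱ : Filtration ℝ≥0 mΩ, (∀ t, Measurable[ℱ t] (X t)) ∧
    ∀ f : S → ℝ, Martingale
      (fun (t : ℝ≥0) (ω : Ω) => f (X t ω) - f (X 0 ω) -
        ∫ s in (0 : ℝ)..(t : ℝ), jumpGenerator (R s) f (X s.toNNReal ω)) ℱ P

/-- Irreducibility: any state is reached from any other one through jumps of positive rate. -/
def Irreducible {S : Type*} (r : S → S → ℝ) : Prop :=
  ∀ x y, Relation.ReflTransGen (fun a b => 0 < r a b) x y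

/-- The perturbed rates `r^λ(s,x,y) = e^{λ g(s,x,y)} r(x,y)`. -/
def perturbedRate {S : Type*} (r : S → S → ℝ) (g : ℝ → S → S → ℝ) (lam : ℝ) :
    ℝ → S → S → ℝ :=
  fun s x y => Real.exp (lam * g s x y) * r x y

theorem perturbedRate_zero {S : Type*} (r : S → S → ℝ) (g : ℝ → S → S → ℝ) (s : ℝ) :
    perturbedRate r g 0 s = r := by
  funext x y
  simp [perturbedRate]

/-- The law `P_ν = ∑ x, ν(x) P_x` with initial distribution `ν`. -/
def lawFrom {S : Type*} [Fintype S] {Ω : Type*} [MeasurableSpace Ω]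
    (P : S → Measure Ω) (ν : S → ℝ) : Measure Ω :=
  ∑ x, ENNReal.ofReal (ν x) • P x

/-- The transition matrix `P_t(x,y) = P_x(X_t = y)`. -/
def transitionMatrix {S : Type*} {Ω : Type*} [MeasurableSpace Ω]
    (P : S → Measure Ω) (X : ℝ≥0 → Ω → S) (t : ℝ≥0) : Matrix S S ℝ :=
  Matrix.of fun x y => (P x).real {ω | X t ω = y}

/-- `ν` is a probability distribution, invariant for the stochastic matrix `Q`. -/
def IsInvariantDistribution {S : Type*} [Fintype S] (Q : Matrix S S ℝ) (ν : S → ℝ) : Prop :=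
  ν ∈ stdSimplex ℝ S ∧ Matrix.vecMul ν Q = ν

/-- The rates of the time-reversed stationary process, `r*(x,y) = π(y) r(y,x) / π(x)`. -/
def reversedRate {S : Type*} (r : S → S → ℝ) (π : S → ℝ) (x y : S) : ℝ :=
  π y * r y x / π x

/-- `ψ_t(x) = ∑ y, (r*(x,y) g(t,y,x) - r(x,y) g(t,x,y))`. -/
def psi {S : Type*} [Fintype S] (r : S → S → ℝ) (g : ℝ → S → S → ℝ) (π : S → ℝ)
    (t : ℝ) (x : S) : ℝ :=
  ∑ y, (reversedRate r π x y * g t y x - r x y * g t x y)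

/-- The `k`-th Fourier coefficient `c_k(f) = T⁻¹ ∫_0^T e^{-ikωt} f(t) dt`, `ω = 2π / T`. -/
def fourierCoefficient (T : ℝ) (k : ℤ) (f : ℝ → ℝ) : ℂ :=
  (1 / (T : ℂ)) * ∫ t in (0 : ℝ)..T,
    Complex.exp (-Complex.I * k * ((2 * Real.pi / T : ℝ) : ℂ) * t) * (f t : ℂ)

/-- The `k`-th Fourier coefficient `ψ̂_k(x)` of `t ↦ ψ_t(x)`. -/
def psiHat {S : Type*} [Fintype S] (r : S → S → ℝ) (g : ℝ → S → S → ℝ) (π : S → ℝ)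
    (T : ℝ) (k : ℤ) (x : S) : ℂ :=
  fourierCoefficient T k (fun t => psi r g π t x)

/-- The mean `f(t) = E_ν[v(X_t)]` of the observable `v` at time `t ≥ 0`. -/
def meanObservable {S : Type*} [Fintype S] {Ω : Type*} [MeasurableSpace Ω]
    (P : S → Measure Ω) (X : ℝ≥0 → Ω → S) (ν : S → ℝ) (v : S → ℝ) (t : ℝ≥0) : ℝ :=
  ∫ ω, v (X t ω) ∂(lawFrom P ν)

/-- The generator of the unperturbed process as an operator on complex functions. -/
def generatorMatrix {S : Type*} [Fintype S] [DecidableEq S] (r : S → S → ℝ) : Matrix S S ℂ :=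
  Matrix.of fun x y => (r x y : ℂ) - if x = y then ∑ z, (r x z : ℂ) else 0

theorem generatorMatrix_mulVec {S : Type*} [Fintype S] [DecidableEq S] (r : S → S → ℝ)
    (f : S → ℂ) (x : S) :
    (generatorMatrix r).mulVec f x = ∑ y, (r x y : ℂ) * (f y - f x) := by
  simp [generatorMatrix, Matrix.mulVec, dotProduct, sub_mul, mul_sub, Finset.sum_sub_distrib,
    Finset.sum_mul]

/-- The scalar product of `L²(π)`, antilinear in the first entry. -/
def innerPi {S : Type*} [Fintype S] (π : S → ℝ) (f h : S → ℂ) : ℂ :=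
  ∑ x, (π x : ℂ) * (starRingEnd ℂ (f x)) * h x

/-- `⟨e^{s(L + ikω)} v, ψ̂_k⟩` in `L²(π)`, `ω = 2π / T`. -/
def semigroupPairing {S : Type*} [Fintype S] [DecidableEq S] (r : S → S → ℝ)
    (g : ℝ → S → S → ℝ) (π : S → ℝ) (T : ℝ) (k : ℤ) (v : S → ℝ) (s : ℝ) : ℂ :=
  innerPi π
    ((NormedSpace.exp ((s : ℂ) • (generatorMatrix r +
      (Complex.I * k * ((2 * Real.pi / T : ℝ) : ℂ)) • (1 : Matrix S S ℂ)))).mulVec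
        (fun x => (v x : ℂ)))
    (psiHat r g π T k)

/-- `e^{-ikωs} E_π[v(X_s) ψ̂_k(X_0)]`, `ω = 2π / T`. -/
def correlation {S : Type*} [Fintype S] {Ω : Type*} [MeasurableSpace Ω]
    (P : S → Measure Ω) (X : ℝ≥0 → Ω → S) (r : S → S → ℝ) (g : ℝ → S → S → ℝ) (π : S → ℝ)
    (T : ℝ) (k : ℤ) (v : S → ℝ) (s : ℝ) : ℂ :=
  Complex.exp (-Complex.I * k * ((2 * Real.pi / T : ℝ) : ℂ) * s) *
    ∫ ω, (v (X s.toNNReal ω) : ℂ) * psiHat r g π T k (X 0 ω) ∂(lawFrom P π)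

end

end JumpLR

/-! Taking expectations in the martingale problem for the indicator of a state shows that the
one-time laws of the process solve the linear forward equation in integral form
(`IsMarkovJumpProcess.isForwardSolution`). From then on the proof concerns this equation, whose
coefficients are only bounded and measurable in time. Gronwall gives uniqueness
(`IsForwardSolution.eq_of_eq_zero`), hence the composition rule over periods. Irreducibility makes
the transition matrices at positive times strictly positive (`IsForwardSolution.pos`), and Doeblin's
contraction gives unique invariant distributions and exponential convergence of `e^{sL}`.

For the response, put `z = -ikω` and `w = ∫_0^∞ e^{zs}(e^{sL}v - π(v)) ds`, so that `(z + L)w = -(v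
- π(v))`. Testing a `T`-periodic forward solution `μ` with rates `q` against `e^{zt}w` makes the
boundary terms cancel over one period and leaves an exact identity
(`IsForwardSolution.integral_exp_mul_eq`): `∫_0^T e^{zt} μ_t(v) dt = ∫_0^T e^{zt} π(v) dt + ∫_0^T
e^{zt} ∑ μ_t(x)(q_t(x,y) - r(x,y))(w(y) - w(x)) dt`. For the perturbed rates the factor `q - r` is
already of order `λ`. So differentiating at `λ = 0` needs only continuity of the steady state there,
not differentiability of `π_λ`. Continuity follows from Duhamel's formula and exponential decay
(`IsForwardSolution.abs_sub_le_of_periodic`).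

Finally `π ψ_t` is the net flow of `π` under the first-order rates `r g`, so summation by parts
rewrites the derivative as the pairing of `ψ̂_k` with `w`. Since `ψ̂_k` has `π`-mean zero, the
centring of the semigroup disappears from the pairing. -/

namespace JumpLR

/-! ### Integration by parts with a bounded measurable derivative -/

section IntegrationByParts

variable {F : Type*} [NormedAddCommGroup F] [NormedSpace ℝ F]

/-- A primitive of a bounded function is Lipschitz. This is the regularity available when the rates
are merely measurable in time. -/
theorem absolutelyContinuousOnInterval_integral_of_bounded {f : ℝ → F} {a b C : ℝ}
    (hf : IntervalIntegrable f volume a b) (hC : ∀ t ∈ Set.uIcc a b, ‖f t‖ ≤ C) :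
    AbsolutelyContinuousOnInterval (fun t => ∫ s in a..t, f s) a b := by
  have hC0 : 0 ≤ C := (norm_nonneg _).trans (hC a Set.left_mem_uIcc)
  refine LipschitzOnWith.absolutelyContinuousOnInterval (K := ⟨C, hC0⟩) ?_
  refine LipschitzOnWith.of_dist_le_mul fun x hx y hy => ?_
  have hsub : ∀ z ∈ Set.uIcc a b, IntervalIntegrable f volume a z := fun z hz =>
    hf.mono_set (Set.uIcc_subset_uIcc Set.left_mem_uIcc hz)
  rw [dist_eq_norm, intervalIntegral.integral_interval_sub_left (hsub x hx) (hsub y hy),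
    Real.dist_eq]
  exact intervalIntegral.norm_integral_le_of_norm_le_const fun t ht =>
    hC t (Set.uIcc_subset_uIcc hy hx (Set.uIoc_subset_uIcc ht))

/-- Integration by parts for the product of an indefinite integral of a bounded function with a
continuously differentiable function. -/
theorem integral_smul_add_smul_deriv [CompleteSpace F] {u u' : ℝ → ℝ} {h h' : ℝ → F} {a b C : ℝ}
    (hu' : IntervalIntegrable u' volume a b) (hC : ∀ t ∈ Set.uIcc a b, |u' t| ≤ C)
    (hu : ∀ t ∈ Set.uIcc a b, u t = u a + ∫ s in a..t, u' s)
    (hh : ∀ t, HasDerivAt h (h' t) t) (hh' : Continuous h') :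
    IntervalIntegrable (fun t => u' t • h t + u t • h' t) volume a b ∧
    ∫ t in a..b, (u' t • h t + u t • h' t) = u b • h b - u a • h a := by
  have hhc : Continuous h := continuous_iff_continuousAt.2 fun t => (hh t).continuousAt
  let U : ℝ → ℝ := fun t => u a + ∫ s in a..t, u' s
  have hUac : AbsolutelyContinuousOnInterval U a b := by
    have h1 := absolutelyContinuousOnInterval_integral_of_bounded hu' hC
    have h2 : AbsolutelyContinuousOnInterval (fun _ : ℝ => u a) a b :=
      (LipschitzWith.const (u a)).lipschitzOnWith.absolutelyContinuousOnInterval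
    exact h2.fun_add h1
  have hUc := hUac.continuousOn
  have hhac : AbsolutelyContinuousOnInterval h a b := by
    refine ContDiffOn.absolutelyContinuousOnInterval (ContDiff.contDiffOn ?_)
    rw [contDiff_one_iff_deriv]
    exact ⟨fun t => (hh t).differentiableAt, by
      rw [show deriv h = h' from funext fun t => (hh t).deriv]; exact hh'⟩
  let k : ℝ → F := fun t => u' t • h t + U t • h' t
  have hk : IntervalIntegrable k volume a b :=
    (hu'.smul_continuousOn hhc.continuousOn).add
      ((hUc.smul hh'.continuousOn).intervalIntegrable)
  obtain ⟨D1, hD1⟩ := isCompact_uIcc.exists_bound_of_continuousOn (s := Set.uIcc a b)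
    hhc.continuousOn
  obtain ⟨D2, hD2⟩ := isCompact_uIcc.exists_bound_of_continuousOn (s := Set.uIcc a b)
    (hUc.smul hh'.continuousOn)
  have hkC : ∀ t ∈ Set.uIcc a b, ‖k t‖ ≤ C * D1 + D2 := fun t ht => by
    refine (norm_add_le _ _).trans (add_le_add ?_ (hD2 t ht))
    rw [norm_smul, Real.norm_eq_abs]
    exact mul_le_mul (hC t ht) (hD1 t ht) (norm_nonneg _) ((abs_nonneg _).trans (hC t ht))
  have hkac := absolutelyContinuousOnInterval_integral_of_bounded hk hkC
  -- The function `U • h - ∫ k` is absolutely continuous with derivative zero almost everywhere,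
  -- hence constant.
  have hW := (hUac.fun_smul hhac).fun_sub hkac
  obtain ⟨c, hc⟩ := hW.const_of_ae_hasDerivAt_zero (by
    filter_upwards [hu'.ae_hasDerivAt_integral, hk.ae_hasDerivAt_integral] with t h1 h2 ht
    have e1 : HasDerivAt U (u' t) t := (h1 ht a Set.left_mem_uIcc).const_add (u a)
    have e2 := h2 ht a Set.left_mem_uIcc
    have e3 := (e1.smul (hh t)).sub e2
    convert! e3 using 1
    simp only [k]
    abel)
  have ha := hc a Set.left_mem_uIcc
  have hb := hc b Set.right_mem_uIcc
  have hUu : ∀ t ∈ Set.uIcc a b, u t = U t := hu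
  have hcongr : Set.EqOn (fun t => u' t • h t + u t • h' t) k (Set.uIcc a b) := fun t ht => by
    simp only [k, hUu t ht]
  refine ⟨hk.congr fun t ht => (hcongr (Set.uIoc_subset_uIcc ht)).symm, ?_⟩
  rw [intervalIntegral.integral_congr hcongr, hUu b Set.right_mem_uIcc, hUu a Set.left_mem_uIcc]
  simp only [intervalIntegral.integral_same, sub_zero] at ha
  rw [← ha] at hb
  rw [sub_eq_iff_eq_add] at hb
  rw [hb]
  abel

end IntegrationByParts
end JumpLR

/-! ### The forward equation: uniqueness, linearity, positivity -/

namespace JumpLR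

variable {S : Type*} [Fintype S]

/-- The net probability flow into `y` of a mass distribution `m` under the rates `q`. -/
def netFlow (q : S → S → ℝ) (m : S → ℝ) (y : S) : ℝ :=
  ∑ x, (m x * q x y - m y * q y x)

theorem sum_netFlow_smul {F : Type*} [AddCommGroup F] [Module ℝ F] (q : S → S → ℝ) (m : S → ℝ)
    (h : S → F) :
    ∑ y, netFlow q m y • h y = ∑ x, ∑ y, (m x * q x y) • (h y - h x) := by
  simp only [netFlow, Finset.sum_smul, sub_smul, smul_sub, Finset.sum_sub_distrib]
  congr 1
  exact Finset.sum_comm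

/-- Time-dependent rates which are measurable, nonnegative and bounded by `C`. -/
structure BoundedRates (q : ℝ → S → S → ℝ) (C : ℝ) : Prop where
  measurable : ∀ x y, Measurable fun s => q s x y
  nonneg : ∀ s x y, 0 ≤ q s x y
  le : ∀ s x y, q s x y ≤ C

/-- A solution `t ↦ μ t`, `t ≥ 0`, of the forward equation `∂ₜ μ = netFlow (q t) (μ t)` in integral
form, with values in the probability distributions. -/
structure IsForwardSolution (q : ℝ → S → S → ℝ) (μ : ℝ → S → ℝ) : Prop where
  mem : ∀ t, μ t ∈ stdSimplex ℝ S
  measurable : ∀ y, Measurable fun t => μ t y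
  eq_integral : ∀ t, 0 ≤ t → ∀ y, μ t y = μ 0 y + ∫ s in (0 : ℝ)..t, netFlow (q s) (μ s) y

theorem abs_le_one_of_mem_stdSimplex {m : S → ℝ} (hm : m ∈ stdSimplex ℝ S) (x : S) :
    |m x| ≤ 1 := by
  rw [abs_of_nonneg (hm.1 x), ← hm.2]
  exact Finset.single_le_sum (fun y _ => hm.1 y) (Finset.mem_univ x)

theorem intervalIntegrable_of_measurable_of_bounded {E : Type*} [NormedAddCommGroup E]
    {f : ℝ → E} {C : ℝ} (hf : AEStronglyMeasurable f) (hC : ∀ t, ‖f t‖ ≤ C) (a b : ℝ) :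
    IntervalIntegrable f volume a b := by
  have h1 : IntervalIntegrable (fun _ : ℝ => C) volume a b := intervalIntegrable_const
  exact h1.mono_fun hf.restrict (Eventually.of_forall fun t =>
    (hC t).trans (le_abs_self C))

namespace BoundedRates

variable {q : ℝ → S → S → ℝ} {C : ℝ}

omit [Fintype S] in
theorem abs_le (hq : BoundedRates q C) (s : ℝ) (x y : S) : |q s x y| ≤ C := by
  rw [abs_of_nonneg (hq.nonneg s x y)]
  exact hq.le s x y

theorem abs_netFlow_le (hq : BoundedRates q C) (s : ℝ) (m : S → ℝ) (y : S) :
    |netFlow (q s) m y| ≤ C * (∑ x, |m x| + Fintype.card S * |m y|) := by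
  have h1 : |netFlow (q s) m y| ≤ ∑ x, (|m x| * C + |m y| * C) :=
    (Finset.abs_sum_le_sum_abs _ _).trans (Finset.sum_le_sum fun x _ => by
      refine (abs_sub _ _).trans ?_
      rw [abs_mul, abs_mul]
      gcongr <;> exact hq.abs_le _ _ _)
  refine h1.trans_eq ?_
  rw [Finset.sum_add_distrib, ← Finset.sum_mul, Finset.sum_const, Finset.card_univ, nsmul_eq_mul]
  ring

end BoundedRates

theorem sum_abs_of_mem_stdSimplex {m : S → ℝ} (hm : m ∈ stdSimplex ℝ S) : ∑ x, |m x| = 1 := by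
  rw [← hm.2]
  exact Finset.sum_congr rfl fun x _ => abs_of_nonneg (hm.1 x)

namespace IsForwardSolution

variable {q : ℝ → S → S → ℝ} {μ ν : ℝ → S → ℝ} {C : ℝ}

theorem abs_netFlow_le (hq : BoundedRates q C) (hC : 0 ≤ C) (hμ : IsForwardSolution q μ) (s : ℝ)
    (y : S) : |netFlow (q s) (μ s) y| ≤ C * (1 + Fintype.card S) := by
  refine (hq.abs_netFlow_le s (μ s) y).trans ?_
  rw [sum_abs_of_mem_stdSimplex (hμ.mem s)]
  have := abs_le_one_of_mem_stdSimplex (hμ.mem s) y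
  gcongr
  nlinarith [(Nat.cast_nonneg (Fintype.card S) : (0 : ℝ) ≤ Fintype.card S)]

theorem measurable_netFlow (hq : BoundedRates q C) (hμ : IsForwardSolution q μ) (y : S) :
    Measurable fun s => netFlow (q s) (μ s) y :=
  Finset.measurable_fun_sum _ fun x _ =>
    ((hμ.measurable x).mul (hq.measurable x y)).sub ((hμ.measurable y).mul (hq.measurable y x))

theorem intervalIntegrable_netFlow (hq : BoundedRates q C) (hC : 0 ≤ C)
    (hμ : IsForwardSolution q μ) (y : S) (a b : ℝ) :
    IntervalIntegrable (fun s => netFlow (q s) (μ s) y) volume a b :=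
  intervalIntegrable_of_measurable_of_bounded
    (measurable_netFlow hq hμ y).aestronglyMeasurable (abs_netFlow_le hq hC hμ · y) a b

theorem eq_add_integral (hq : BoundedRates q C) (hC : 0 ≤ C) (hμ : IsForwardSolution q μ)
    {a t : ℝ} (ha : 0 ≤ a) (ht : a ≤ t) (y : S) :
    μ t y = μ a y + ∫ s in a..t, netFlow (q s) (μ s) y := by
  rw [hμ.eq_integral t (ha.trans ht) y, hμ.eq_integral a ha y, add_assoc,
    intervalIntegral.integral_add_adjacent_intervals] <;>
  exact intervalIntegrable_netFlow hq hC hμ y _ _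

/-- Time-dependent test functions in the forward equation. -/
theorem dynkin {F : Type*} [NormedAddCommGroup F] [NormedSpace ℝ F] [CompleteSpace F]
    (hq : BoundedRates q C) (hC : 0 ≤ C) (hμ : IsForwardSolution q μ) {a b : ℝ} (ha : 0 ≤ a)
    (hab : a ≤ b) {h h' : ℝ → S → F} (hh : ∀ y t, HasDerivAt (fun s => h s y) (h' t y) t)
    (hh' : ∀ y, Continuous fun s => h' s y) :
    ∑ y, μ b y • h b y - ∑ y, μ a y • h a y =
      ∫ s in a..b, (∑ x, μ s x • h' s x +
        ∑ x, ∑ y, (μ s x * q s x y) • (h s y - h s x)) := by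
  have key := fun y => integral_smul_add_smul_deriv (u := fun t => μ t y)
    (u' := fun s => netFlow (q s) (μ s) y) (h := fun s => h s y) (h' := fun s => h' s y)
    (intervalIntegrable_netFlow hq hC hμ y a b) (fun t _ => abs_netFlow_le hq hC hμ t y)
    (fun t ht => eq_add_integral hq hC hμ ha (by
      rw [Set.uIcc_of_le hab] at ht; exact ht.1) y) (hh y) (hh' y)
  rw [← Finset.sum_sub_distrib, Finset.sum_congr rfl fun y _ => (key y).2.symm,
    ← intervalIntegral.integral_finsetSum fun y _ => (key y).1]
  refine intervalIntegral.integral_congr fun s _ => ?_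
  simp only [← sum_netFlow_smul, Finset.sum_add_distrib]
  rw [add_comm]

theorem continuousOn (hq : BoundedRates q C) (hC : 0 ≤ C) (hμ : IsForwardSolution q μ) (y : S) :
    ContinuousOn (fun t => μ t y) (Set.Ici 0) := by
  have h1 : Continuous fun t => μ 0 y + ∫ s in (0 : ℝ)..t, netFlow (q s) (μ s) y :=
    continuous_const.add (intervalIntegral.continuous_primitive
      (fun a b => intervalIntegrable_netFlow hq hC hμ y a b) 0)
  exact h1.continuousOn.congr fun t ht => hμ.eq_integral t ht y

/-- Gronwall's inequality for the `ℓ¹` distance of the two solutions. -/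
theorem eq_of_eq_zero (hq : BoundedRates q C) (hC : 0 ≤ C) (hμ : IsForwardSolution q μ)
    (hν : IsForwardSolution q ν) (h0 : μ 0 = ν 0) {t : ℝ} (ht : 0 ≤ t) : μ t = ν t := by
  -- The equation says nothing at negative times; freezing them at `0` makes `N` continuous on the
  -- whole line.
  let N : ℝ → ℝ := fun s => ∑ y, |μ (max s 0) y - ν (max s 0) y|
  have hm : Continuous fun s : ℝ => max s 0 := continuous_id.max continuous_const
  have hyc : ∀ y, Continuous fun s => |μ (max s 0) y - ν (max s 0) y| := fun y =>
    (((continuousOn hq hC hμ y).comp_continuous hm fun s => Set.mem_Ici.2 (le_max_right _ _)).sub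
      ((continuousOn hq hC hν y).comp_continuous hm fun s =>
        Set.mem_Ici.2 (le_max_right _ _))).abs
  have hNc : Continuous N := continuous_finsetSum _ fun y _ => hyc y
  have hN0 : ∀ s, 0 ≤ N s := fun s => Finset.sum_nonneg fun y _ => abs_nonneg _
  let K : ℝ := C * (Fintype.card S + Fintype.card S)
  have hK : 0 ≤ K := by positivity
  have hle : ∀ s, 0 ≤ s → N s ≤ K * ∫ u in (0 : ℝ)..s, N u := by
    intro s hs
    have hi : ∀ y, IntervalIntegrable (fun u => C * (N u + Fintype.card S *
        |μ (max u 0) y - ν (max u 0) y|)) volume 0 s := fun y =>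
      (continuous_const.mul (hNc.add (continuous_const.mul (hyc y)))).intervalIntegrable _ _
    have hy : ∀ y, |μ s y - ν s y| ≤
        ∫ u in (0 : ℝ)..s, C * (N u + Fintype.card S * |μ (max u 0) y - ν (max u 0) y|) := by
      intro y
      rw [hμ.eq_integral s hs y, hν.eq_integral s hs y, h0, add_sub_add_left_eq_sub,
        ← intervalIntegral.integral_sub (intervalIntegrable_netFlow hq hC hμ y _ _)
          (intervalIntegrable_netFlow hq hC hν y _ _), ← Real.norm_eq_abs]
      refine intervalIntegral.norm_integral_le_of_norm_le hs ?_ ?_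
      · refine ae_of_all _ fun u hu => ?_
        have e : netFlow (q u) (μ u) y - netFlow (q u) (ν u) y =
            netFlow (q u) (fun x => μ u x - ν u x) y := by
          simp only [netFlow, ← Finset.sum_sub_distrib]
          exact Finset.sum_congr rfl fun x _ => by ring
        rw [e, Real.norm_eq_abs]
        have := hq.abs_netFlow_le u (fun x => μ u x - ν u x) y
        simpa only [N, max_eq_left hu.1.le] using this
      · exact hi y
    calc N s = ∑ y, |μ s y - ν s y| := by simp only [N, max_eq_left hs]
      _ ≤ _ := Finset.sum_le_sum fun y _ => hy y
      _ = ∫ u in (0 : ℝ)..s, K * N u := by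
        rw [← intervalIntegral.integral_finsetSum fun y _ => hi y]
        refine intervalIntegral.integral_congr fun u _ => ?_
        simp only [← Finset.mul_sum, Finset.sum_add_distrib, Finset.sum_const, Finset.card_univ,
          nsmul_eq_mul, K]
        simp only [N]
        ring
      _ = _ := intervalIntegral.integral_const_mul _ _
  have hI : ∀ s, HasDerivAt (fun s => ∫ u in (0 : ℝ)..s, N u) (N s) s := fun s =>
    hNc.integral_hasStrictDerivAt 0 s |>.hasDerivAt
  have hI0 : ∀ s, 0 ≤ s → 0 ≤ ∫ u in (0 : ℝ)..s, N u := fun s hs =>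
    intervalIntegral.integral_nonneg hs fun u _ => hN0 u
  -- Gronwall is applied to the primitive of `N`, which is differentiable: `hle` bounds its
  -- derivative `N` by `K` times itself.
  have hzero := norm_le_gronwallBound_of_norm_deriv_right_le (δ := 0) (K := K) (ε := 0) (a := 0)
    (b := t) (f := fun s => ∫ u in (0 : ℝ)..s, N u) (f' := N)
    (fun s _ => (hI s).continuousAt.continuousWithinAt) (fun s _ => (hI s).hasDerivWithinAt)
    (by simp) (fun s hs => by
      rw [Real.norm_of_nonneg (hN0 s), Real.norm_of_nonneg (hI0 s hs.1), add_zero]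
      exact hle s hs.1) t ⟨ht, le_rfl⟩
  have hgb : gronwallBound 0 K 0 (t - 0) = 0 := by
    rw [gronwallBound_ε0]; simp
  rw [hgb] at hzero
  have hIt : ∫ u in (0 : ℝ)..t, N u = 0 := norm_le_zero_iff.1 hzero
  have hNt : N t = 0 := le_antisymm (by simpa [hIt] using hle t ht) (hN0 t)
  funext y
  have := (Finset.sum_eq_zero_iff_of_nonneg fun y _ => abs_nonneg _).1 hNt y (Finset.mem_univ y)
  rw [max_eq_left ht, abs_eq_zero] at this
  linarith

theorem shift (hq : BoundedRates q C) (hC : 0 ≤ C) (hμ : IsForwardSolution q μ) {a : ℝ}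
    (ha : 0 ≤ a) (hper : ∀ s, q (s + a) = q s) : IsForwardSolution q fun t => μ (t + a) where
  mem t := hμ.mem _
  measurable y := (hμ.measurable y).comp (measurable_id.add_const a)
  eq_integral t ht y := by
    rw [eq_add_integral hq hC hμ ha (le_add_of_nonneg_left ht) y, zero_add]
    have := intervalIntegral.integral_comp_add_right (a := 0) (b := t)
      (fun s => netFlow (q s) (μ s) y) a
    rw [zero_add] at this
    rw [← this]
    simp only [hper]

theorem mix (hq : BoundedRates q C) (hC : 0 ≤ C) {p : ℝ → Matrix S S ℝ}
    (hp : ∀ x, IsForwardSolution q fun t => p t x) {m : S → ℝ} (hm : m ∈ stdSimplex ℝ S) :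
    IsForwardSolution q fun t => Matrix.vecMul m (p t) where
  mem t := by
    refine ⟨fun y => Finset.sum_nonneg fun x _ => mul_nonneg (hm.1 x) (((hp x).mem t).1 y), ?_⟩
    simp only [Matrix.vecMul, dotProduct]
    rw [Finset.sum_comm, ← hm.2]
    refine Finset.sum_congr rfl fun x _ => ?_
    rw [← Finset.mul_sum, ((hp x).mem t).2, mul_one]
  measurable y := Finset.measurable_fun_sum _ fun x _ => ((hp x).measurable y).const_mul _
  eq_integral t ht y := by
    have e : ∀ s, netFlow (q s) (Matrix.vecMul m (p s)) y =
        ∑ x, m x * netFlow (q s) (p s x) y := by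
      intro s
      simp only [netFlow, Matrix.vecMul, dotProduct, Finset.mul_sum, Finset.sum_mul,
        Finset.sum_sub_distrib, mul_sub]
      congr 1 <;> rw [Finset.sum_comm] <;> simp only [mul_assoc]
    simp only [e]
    rw [intervalIntegral.integral_finsetSum fun x _ =>
      (intervalIntegrable_netFlow hq hC (hp x) y _ _).const_mul _]
    simp only [intervalIntegral.integral_const_mul, Matrix.vecMul, dotProduct,
      ← Finset.sum_add_distrib, ← mul_add]
    exact Finset.sum_congr rfl fun x _ => by rw [(hp x).eq_integral t ht y]

theorem intervalIntegrable_exp_mul (hq : BoundedRates q C) (hμ : IsForwardSolution q μ)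
    (c a b : ℝ) (x y : S) :
    IntervalIntegrable (fun s => Real.exp (c * s) * (μ s x * q s x y)) volume a b := by
  refine IntervalIntegrable.continuousOn_mul ?_ (Continuous.continuousOn (by fun_prop))
  refine intervalIntegrable_of_measurable_of_bounded (C := 1 * C)
    ((hμ.measurable x).mul (hq.measurable x y)).aestronglyMeasurable (fun t => ?_) _ _
  rw [Pi.mul_apply, norm_mul]
  exact mul_le_mul (abs_le_one_of_mem_stdSimplex (hμ.mem t) x) (hq.abs_le _ _ _)
    (norm_nonneg _) zero_le_one

/-- The outflow rate from `y` is at most `C * card S`. With the corresponding integrating factor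
only inflow remains, and it is at least the inflow from the single state `x`. -/
theorem exp_mul_add_integral_le (hq : BoundedRates q C) (hC : 0 ≤ C) (hμ : IsForwardSolution q μ)
    {a b : ℝ} (ha : 0 ≤ a) (hab : a ≤ b) (x y : S) :
    Real.exp (C * Fintype.card S * a) * μ a y +
      ∫ s in a..b, Real.exp (C * Fintype.card S * s) * (μ s x * q s x y) ≤
      Real.exp (C * Fintype.card S * b) * μ b y := by
  set c : ℝ := C * Fintype.card S with hc
  have hexp : ∀ t, HasDerivAt (fun s => Real.exp (c * s)) (c * Real.exp (c * t)) t := fun t => by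
    simpa [mul_comm] using ((hasDerivAt_id t).const_mul c).exp
  have key := integral_smul_add_smul_deriv (u := fun t => μ t y)
    (u' := fun s => netFlow (q s) (μ s) y) (h := fun s => Real.exp (c * s))
    (h' := fun s => c * Real.exp (c * s))
    (intervalIntegrable_netFlow hq hC hμ y a b) (fun t _ => abs_netFlow_le hq hC hμ t y)
    (fun t ht => eq_add_integral hq hC hμ ha (by
      rw [Set.uIcc_of_le hab] at ht; exact ht.1) y) hexp (by fun_prop)
  have hmono := intervalIntegral.integral_mono_on hab (intervalIntegrable_exp_mul hq hμ c a b x y) key.1 fun s _ => by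
    have hm := (hμ.mem s).1
    have h1 : μ s x * q s x y ≤ ∑ z, μ s z * q s z y :=
      Finset.single_le_sum (f := fun z => μ s z * q s z y)
        (fun z _ => mul_nonneg (hm z) (hq.nonneg _ _ _)) (Finset.mem_univ x)
    have h2 : ∑ z, μ s y * q s y z ≤ μ s y * c := by
      rw [← Finset.mul_sum]
      refine mul_le_mul_of_nonneg_left ?_ (hm y)
      calc ∑ z, q s y z ≤ ∑ _z : S, C := Finset.sum_le_sum fun z _ => hq.le _ _ _
        _ = c := by simp [hc, mul_comm]
    have h3 : μ s x * q s x y ≤ netFlow (q s) (μ s) y + μ s y * c := by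
      simp only [netFlow, Finset.sum_sub_distrib]
      linarith
    calc _ ≤ Real.exp (c * s) * (netFlow (q s) (μ s) y + μ s y * c) :=
          mul_le_mul_of_nonneg_left h3 (Real.exp_pos _).le
      _ = netFlow (q s) (μ s) y • Real.exp (c * s) + μ s y • (c * Real.exp (c * s)) := by
          simp only [smul_eq_mul]; ring
  rw [key.2] at hmono
  simp only [smul_eq_mul] at hmono
  linarith

/-- For irreducible rates all states have positive probability at positive times. -/
theorem pos (hq : BoundedRates q C) (hC : 0 ≤ C) (hμ : IsForwardSolution q μ)
    {r : S → S → ℝ} (hirr : Irreducible r) (hpos : ∀ s x y, 0 < r x y → 0 < q s x y)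
    {t : ℝ} (ht : 0 < t) (y : S) : 0 < μ t y := by
  have hnn : ∀ s x y, 0 ≤ Real.exp (C * Fintype.card S * s) * (μ s x * q s x y) := fun s x y =>
    mul_nonneg (Real.exp_pos _).le (mul_nonneg ((hμ.mem s).1 x) (hq.nonneg _ _ _))
  obtain ⟨x, hx⟩ : ∃ x, 0 < μ 0 x := by
    by_contra! h
    have := (hμ.mem 0).2
    linarith [Finset.sum_nonpos fun x (_ : x ∈ Finset.univ) => h x]
  have hreach := hirr x y
  -- Positivity spreads along a path from a state charged at time `0`. The time is generalised
  -- because the inflow from `z` must be positive on all of `(0, t)`.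
  induction hreach generalizing t with
  | refl =>
    have h1 := exp_mul_add_integral_le hq hC hμ le_rfl ht.le x x
    have h2 := intervalIntegral.integral_nonneg (μ := volume) ht.le fun s _ => hnn s x x
    have h3 : 0 < Real.exp (C * Fintype.card S * t) * μ t x :=
      lt_of_lt_of_le (by positivity) ((le_add_of_nonneg_right h2).trans h1)
    exact pos_of_mul_pos_right h3 (Real.exp_pos _).le
  | @tail z w _ hzw ih =>
    have h1 := exp_mul_add_integral_le hq hC hμ le_rfl ht.le z w
    have h2 := intervalIntegral.intervalIntegral_pos_of_pos_on
      (intervalIntegrable_exp_mul hq hμ (C * Fintype.card S) 0 t z w)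
      (fun s hs => mul_pos (Real.exp_pos _) (mul_pos (ih hs.1) (hpos s z w hzw))) ht
    have h3 : 0 < Real.exp (C * Fintype.card S * t) * μ t w := by
      refine lt_of_lt_of_le h2 (le_trans ?_ h1)
      exact le_add_of_nonneg_left (mul_nonneg (Real.exp_pos _).le ((hμ.mem 0).1 w))
    exact pos_of_mul_pos_right h3 (Real.exp_pos _).le

end IsForwardSolution
end JumpLR

/-! ### Stochastic matrices and transition families -/

namespace JumpLR

section StochasticMatrix

variable {S : Type*} [Fintype S] {Q : Matrix S S ℝ}

theorem sum_vecMul_of_stochastic (hQ : ∀ x, Q x ∈ stdSimplex ℝ S) (m : S → ℝ) :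
    ∑ y, Matrix.vecMul m Q y = ∑ x, m x := by
  simp only [Matrix.vecMul, dotProduct]
  rw [Finset.sum_comm]
  exact Finset.sum_congr rfl fun x _ => by rw [← Finset.mul_sum, (hQ x).2, mul_one]

/-- Doeblin's contraction estimate. -/
theorem sum_abs_vecMul_le (hQ : ∀ x, Q x ∈ stdSimplex ℝ S) {ε : ℝ} (hε : ∀ x y, ε ≤ Q x y)
    {m : S → ℝ} (hm : ∑ x, m x = 0) :
    ∑ y, |Matrix.vecMul m Q y| ≤ (1 - Fintype.card S * ε) * ∑ x, |m x| := by
  -- As `m` has total mass zero, `ε` may be subtracted from every entry of `Q`; the entries stay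
  -- nonnegative and the row sums drop to `1 - card S * ε`.
  have h1 : ∀ y, Matrix.vecMul m Q y = ∑ x, m x * (Q x y - ε) := fun y => by
    simp only [mul_sub, Finset.sum_sub_distrib, ← Finset.sum_mul, hm, Matrix.vecMul, dotProduct]
    ring
  calc ∑ y, |Matrix.vecMul m Q y| ≤ ∑ y, ∑ x, |m x| * (Q x y - ε) :=
        Finset.sum_le_sum fun y _ => by
          rw [h1]
          refine (Finset.abs_sum_le_sum_abs _ _).trans_eq (Finset.sum_congr rfl fun x _ => ?_)
          rw [abs_mul, abs_of_nonneg (sub_nonneg.2 (hε x y))]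
    _ = ∑ x, |m x| * ∑ y, (Q x y - ε) := by
        rw [Finset.sum_comm]
        simp only [Finset.mul_sum]
    _ = _ := by
        simp only [Finset.sum_sub_distrib, (hQ _).2, Finset.sum_const, Finset.card_univ,
          nsmul_eq_mul]
        rw [← Finset.sum_mul, mul_comm]

/-- `Q` fixes the constants, so `1` is an eigenvalue and has a left eigenvector `m`. Then `|m| ≤ |m|
Q` entrywise while both sides have the same total mass, so `|m|` is itself fixed and can be
normalised. -/
theorem exists_isInvariantDistribution [Nonempty S] (hQ : ∀ x, Q x ∈ stdSimplex ℝ S) :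
    ∃ ν, IsInvariantDistribution Q ν := by
  classical
  have hdet : (Q - 1).det = 0 := by
    refine Matrix.exists_mulVec_eq_zero_iff.1 ⟨fun _ => 1, ?_, ?_⟩
    · obtain ⟨x⟩ := ‹Nonempty S›
      exact fun h => one_ne_zero (congrFun h x)
    · funext x
      simp [Matrix.mulVec, dotProduct, Matrix.sub_apply, Matrix.one_apply, (hQ x).2]
  obtain ⟨m, hm0, hm⟩ := Matrix.exists_vecMul_eq_zero_iff.2 hdet
  rw [Matrix.vecMul_sub, Matrix.vecMul_one, sub_eq_zero] at hm
  have hle : ∀ y, |m y| ≤ Matrix.vecMul (fun x => |m x|) Q y := fun y => by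
    conv_lhs => rw [← hm]
    refine (Finset.abs_sum_le_sum_abs _ _).trans_eq (Finset.sum_congr rfl fun x _ => ?_)
    rw [abs_mul, abs_of_nonneg ((hQ x).1 y)]
  have heq : Matrix.vecMul (fun x => |m x|) Q = fun x => |m x| := by
    funext y
    exact (((Finset.sum_eq_sum_iff_of_le fun y _ => hle y).1
      (sum_vecMul_of_stochastic hQ _).symm) y (Finset.mem_univ y)).symm
  have hpos : 0 < ∑ x, |m x| := by
    obtain ⟨x, hx⟩ := Function.ne_iff.1 hm0
    exact Finset.sum_pos' (fun x _ => abs_nonneg _) ⟨x, Finset.mem_univ x, abs_pos.2 hx⟩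
  refine ⟨(∑ x, |m x|)⁻¹ • fun x => |m x|, ⟨fun x => ?_, ?_⟩, ?_⟩
  · simp only [Pi.smul_apply, smul_eq_mul]
    positivity
  · simp only [Pi.smul_apply, smul_eq_mul, ← Finset.mul_sum]
    exact inv_mul_cancel₀ hpos.ne'
  · rw [Matrix.smul_vecMul, heq]

theorem exists_pos_le_of_pos [Nonempty S] (hpos : ∀ x y, 0 < Q x y) :
    ∃ ε, 0 < ε ∧ ∀ x y, ε ≤ Q x y := by
  obtain ⟨z, hz⟩ := Finite.exists_min fun z : S × S => Q z.1 z.2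
  exact ⟨Q z.1 z.2, hpos _ _, fun x y => hz (x, y)⟩

theorem IsInvariantDistribution.eq [Nonempty S] (hQ : ∀ x, Q x ∈ stdSimplex ℝ S)
    (hpos : ∀ x y, 0 < Q x y) {ν ν' : S → ℝ} (hν : IsInvariantDistribution Q ν)
    (hν' : IsInvariantDistribution Q ν') : ν = ν' := by
  obtain ⟨ε, hε, hle⟩ := exists_pos_le_of_pos hpos
  have h1 := sum_abs_vecMul_le hQ hle (m := ν - ν') (by
    simp [Finset.sum_sub_distrib, hν.1.2, hν'.1.2])
  rw [Matrix.sub_vecMul, hν.2, hν'.2] at h1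
  have hcard : 0 < (Fintype.card S : ℝ) := by exact_mod_cast Fintype.card_pos
  have h0 : 0 ≤ ∑ x, |(ν - ν') x| := Finset.sum_nonneg fun x _ => abs_nonneg _
  have hz : ∑ x, |(ν - ν') x| = 0 := by nlinarith [mul_pos hcard hε]
  funext x
  have := (Finset.sum_eq_zero_iff_of_nonneg fun x _ => abs_nonneg _).1 hz x (Finset.mem_univ x)
  exact sub_eq_zero.1 (abs_eq_zero.1 this)

theorem existsUnique_isInvariantDistribution [Nonempty S] (hQ : ∀ x, Q x ∈ stdSimplex ℝ S)
    (hpos : ∀ x y, 0 < Q x y) : ∃! ν, IsInvariantDistribution Q ν := by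
  obtain ⟨ν, hν⟩ := exists_isInvariantDistribution hQ
  exact ⟨ν, hν, fun ν' hν' => hν'.eq hQ hpos hν⟩

end StochasticMatrix

section TransitionFamily

variable {S : Type*} [Fintype S] [DecidableEq S]

/-- Transition probabilities `p t x y` from time `0` to time `t ≥ 0` for the rates `q`. -/
structure IsTransitionFamily (q : ℝ → S → S → ℝ) (p : ℝ → Matrix S S ℝ) : Prop where
  isForwardSolution : ∀ x, IsForwardSolution q fun t => p t x
  zero : p 0 = 1

namespace IsTransitionFamily

variable {q : ℝ → S → S → ℝ} {p : ℝ → Matrix S S ℝ} {C : ℝ}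

theorem mem (hp : IsTransitionFamily q p) (t : ℝ) (x : S) : p t x ∈ stdSimplex ℝ S :=
  (hp.isForwardSolution x).mem t

/-- Uniqueness of the forward equation takes the place of the Markov property: composition rules for
transition matrices come from here. -/
theorem eq_vecMul (hq : BoundedRates q C) (hC : 0 ≤ C) (hp : IsTransitionFamily q p)
    {μ : ℝ → S → ℝ} (hμ : IsForwardSolution q μ) {t : ℝ} (ht : 0 ≤ t) :
    μ t = Matrix.vecMul (μ 0) (p t) :=
  hμ.eq_of_eq_zero hq hC (IsForwardSolution.mix hq hC hp.isForwardSolution (hμ.mem 0))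
    (by simp [hp.zero]) ht

/-- Shift of a forward solution by a period of the rates. -/
theorem vecMul_add (hq : BoundedRates q C) (hC : 0 ≤ C) (hp : IsTransitionFamily q p)
    {a : ℝ} (ha : 0 ≤ a) (hper : ∀ s, q (s + a) = q s) {m : S → ℝ} (hm : m ∈ stdSimplex ℝ S)
    {t : ℝ} (ht : 0 ≤ t) :
    Matrix.vecMul m (p (t + a)) = Matrix.vecMul (Matrix.vecMul m (p a)) (p t) := by
  have h1 := (IsForwardSolution.mix hq hC hp.isForwardSolution hm).shift hq hC ha hper
  simpa using hp.eq_vecMul hq hC h1 ht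

end IsTransitionFamily

end TransitionFamily
end JumpLR

/-! ### The semigroup of constant rates, Duhamel's formula, exponential ergodicity -/

namespace JumpLR

variable {S : Type*} [Fintype S] [DecidableEq S]

section Semigroup

open scoped Matrix.Norms.Operator

/-- The semigroup `e^{sL}` of the generator with constant rates `r`. -/
noncomputable def semigroup (r : S → S → ℝ) (s : ℝ) (f : S → ℂ) : S → ℂ :=
  (NormedSpace.exp ((s : ℂ) • generatorMatrix r)).mulVec f

theorem semigroup_zero (r : S → S → ℝ) (f : S → ℂ) : semigroup r 0 f = f := by
  simp [semigroup]

theorem hasDerivAt_semigroup (r : S → S → ℝ) (f : S → ℂ) (x : S) (s : ℝ) :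
    HasDerivAt (fun t => semigroup r t f x)
      (∑ y, r x y • (semigroup r s f y - semigroup r s f x)) s := by
  have h1 : HasDerivAt (fun t : ℝ => NormedSpace.exp ((t : ℂ) • generatorMatrix r))
      (generatorMatrix r * NormedSpace.exp ((s : ℂ) • generatorMatrix r)) s := by
    have h := HasDerivAt.scomp s (hasDerivAt_exp_smul_const' (𝕂 := ℂ) (generatorMatrix r) (s : ℂ))
      Complex.ofRealCLM.hasDerivAt
    rw [Complex.ofRealCLM_apply, Complex.ofReal_one, one_smul] at h
    exact h
  let ev : Matrix S S ℂ →ₗ[ℝ] ℂ :=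
    { toFun := fun A => A.mulVec f x
      map_add' := fun A B => by simp [Matrix.add_mulVec]
      map_smul' := fun c A => by simp [Matrix.smul_mulVec] }
  have h2 := (LinearMap.toContinuousLinearMap ev).hasFDerivAt.comp_hasDerivAt s h1
  convert! h2 using 1
  change _ = Matrix.mulVec (generatorMatrix r * _) f x
  rw [← Matrix.mulVec_mulVec, generatorMatrix_mulVec]
  simp [semigroup]

end Semigroup

theorem continuous_semigroup (r : S → S → ℝ) (f : S → ℂ) (x : S) :
    Continuous fun t => semigroup r t f x :=
  continuous_iff_continuousAt.2 fun t => (hasDerivAt_semigroup r f x t).continuousAt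

theorem exp_smul_add_smul_one_mulVec (r : S → S → ℝ) (s : ℝ) (z : ℂ) (f : S → ℂ) :
    (NormedSpace.exp ((s : ℂ) • (generatorMatrix r + z • (1 : Matrix S S ℂ)))).mulVec f =
      Complex.exp (z * s) • semigroup r s f := by
  rw [smul_add, smul_smul, Matrix.exp_add_of_commute _ _ ((Commute.one_right _).smul_right _)]
  have h1 : NormedSpace.exp (((s : ℂ) * z) • (1 : Matrix S S ℂ)) =
      Complex.exp (z * s) • (1 : Matrix S S ℂ) := by
    rw [← Matrix.diagonal_one, ← Matrix.diagonal_smul, Matrix.exp_diagonal, ← Matrix.diagonal_smul]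
    congr 1
    funext x
    rw [Pi.coe_exp]
    simp [Complex.exp_eq_exp_ℂ, mul_comm]
  rw [h1, Matrix.mul_smul, mul_one, Matrix.smul_mulVec, semigroup]

/-- Duhamel's formula for a forward solution compared with the semigroup of constant rates. -/
theorem IsForwardSolution.sum_smul_eq {q : ℝ → S → S → ℝ} {μ : ℝ → S → ℝ} {C : ℝ}
    (hq : BoundedRates q C) (hC : 0 ≤ C) (hμ : IsForwardSolution q μ) (r : S → S → ℝ)
    (f : S → ℂ) {t : ℝ} (ht : 0 ≤ t) :
    ∑ y, μ t y • f y = ∑ x, μ 0 x • semigroup r t f x +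
      ∫ s in (0 : ℝ)..t, ∑ x, ∑ y, (μ s x * (q s x y - r x y)) •
        (semigroup r (t - s) f y - semigroup r (t - s) f x) := by
  -- The test function `e^{(t-s)L} f` has time derivative `-L e^{(t-s)L} f`, which cancels the part
  -- of the generator with rates `r` and leaves `q - r`.
  have key := hμ.dynkin hq hC le_rfl ht (h := fun s y => semigroup r (t - s) f y)
    (h' := fun s x => -∑ y, r x y • (semigroup r (t - s) f y - semigroup r (t - s) f x))
    (fun x s => by
      have := (hasDerivAt_semigroup r f x (t - s)).scomp s ((hasDerivAt_id s).const_sub t)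
      simpa [Function.comp_def] using this)
    (fun x => by
      have := continuous_semigroup r f
      fun_prop)
  simp only [sub_self, sub_zero, semigroup_zero] at key
  rw [sub_eq_iff_eq_add'] at key
  rw [key]
  congr 1
  refine intervalIntegral.integral_congr fun s _ => ?_
  rw [← Finset.sum_add_distrib]
  refine Finset.sum_congr rfl fun x _ => ?_
  rw [smul_neg, Finset.smul_sum, neg_add_eq_sub, ← Finset.sum_sub_distrib]
  refine Finset.sum_congr rfl fun y _ => ?_
  rw [smul_smul, ← sub_smul, mul_sub]

section Stationary

variable {r : S → S → ℝ} {p : ℝ → Matrix S S ℝ} {C : ℝ}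

/-- Duhamel's formula with `q = r` has no error term, which identifies the matrix exponential with
the transition probabilities. -/
theorem IsTransitionFamily.semigroup_eq (hr : BoundedRates (fun _ => r) C) (hC : 0 ≤ C)
    (hp : IsTransitionFamily (fun _ => r) p) (f : S → ℂ) {t : ℝ} (ht : 0 ≤ t) (x : S) :
    semigroup r t f x = ∑ y, p t x y • f y := by
  rw [(hp.isForwardSolution x).sum_smul_eq hr hC r f ht]
  simp [hp.zero, Matrix.one_apply]

theorem IsTransitionFamily.exists_sum_abs_sub_le [Nonempty S]
    (hr : BoundedRates (fun _ => r) C) (hC : 0 ≤ C)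
    (hp : IsTransitionFamily (fun _ => r) p) (hirr : Irreducible r) {π : S → ℝ}
    (hπ : IsInvariantDistribution (p 1) π) :
    ∃ K c : ℝ, 0 ≤ K ∧ 0 < c ∧ ∀ t, 0 ≤ t → ∀ x, ∑ y, |p t x y - π y| ≤ K * Real.exp (-c * t) := by
  have hpos : ∀ x y, 0 < p 1 x y := fun x y =>
    (hp.isForwardSolution x).pos hr hC hirr (fun _ _ _ h => h) one_pos y
  obtain ⟨ε, hε, hle⟩ := exists_pos_le_of_pos hpos
  have hcard : 0 < (Fintype.card S : ℝ) := by exact_mod_cast Fintype.card_pos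
  -- The maximum with `1/2` keeps `ρ` positive, so that `log ρ` can serve as a rate even if the
  -- Doeblin factor is `0`.
  set ρ : ℝ := max (1 - Fintype.card S * ε) 2⁻¹ with hρ
  have hρ0 : 0 < ρ := lt_of_lt_of_le (by norm_num) (le_max_right _ _)
  have hρ1 : ρ < 1 := max_lt (by nlinarith [mul_pos hcard hε]) (by norm_num)
  have hstep : ∀ t, 0 ≤ t → ∀ x, ∑ y, |p (t + 1) x y - π y| ≤ ρ * ∑ y, |p t x y - π y| := by
    intro t ht x
    have e : p (t + 1) x = Matrix.vecMul (p t x) (p 1) := by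
      have h1 := (hp.isForwardSolution x).shift hr hC ht fun _ => rfl
      have h2 := hp.eq_vecMul hr hC h1 zero_le_one
      simpa [add_comm] using h2
    have h3 := sum_abs_vecMul_le (fun x => hp.mem 1 x) hle (m := p t x - π) (by
      simp [Finset.sum_sub_distrib, hπ.1.2, (hp.mem t x).2])
    rw [Matrix.sub_vecMul, hπ.2, ← e] at h3
    refine h3.trans (mul_le_mul_of_nonneg_right (le_max_left _ _)
      (Finset.sum_nonneg fun y _ => abs_nonneg _))
  have hiter : ∀ (n : ℕ) (t : ℝ), 0 ≤ t → ∀ x, ∑ y, |p (t + n) x y - π y| ≤ 2 * ρ ^ n := by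
    intro n
    induction n with
    | zero =>
      intro t ht x
      simp only [Nat.cast_zero, add_zero, pow_zero, mul_one]
      calc ∑ y, |p t x y - π y| ≤ ∑ y, (|p t x y| + |π y|) :=
            Finset.sum_le_sum fun y _ => abs_sub _ _
        _ = 2 := by
            rw [Finset.sum_add_distrib, sum_abs_of_mem_stdSimplex (hp.mem t x),
              sum_abs_of_mem_stdSimplex hπ.1]
            norm_num
    | succ n ih =>
      intro t ht x
      have h1 := hstep (t + n) (by positivity) x
      rw [add_assoc] at h1
      rw [Nat.cast_succ]
      calc _ ≤ _ := h1
        _ ≤ ρ * (2 * ρ ^ n) := mul_le_mul_of_nonneg_left (ih t ht x) hρ0.le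
        _ = _ := by ring
  -- Contraction over unit times starts from the fractional part of `t`; `2` bounds the initial `ℓ¹`
  -- distance, and `ρ⁻¹` pays for replacing `⌊t⌋` by `t - 1`.
  refine ⟨2 * ρ⁻¹, -Real.log ρ, by positivity, neg_pos.2 (Real.log_neg hρ0 hρ1), fun t ht x => ?_⟩
  have h1 := hiter ⌊t⌋₊ (t - ⌊t⌋₊) (sub_nonneg.2 (Nat.floor_le ht)) x
  rw [sub_add_cancel] at h1
  refine h1.trans ?_
  rw [mul_assoc, neg_neg, ← Real.rpow_def_of_pos hρ0, ← Real.rpow_natCast, ← Real.rpow_neg_one,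
    ← Real.rpow_add hρ0]
  refine mul_le_mul_of_nonneg_left ?_ zero_le_two
  refine Real.rpow_le_rpow_of_exponent_ge hρ0 hρ1.le ?_
  linarith [Nat.lt_floor_add_one t]

end Stationary
end JumpLR

/-! ### Periodic forward solutions and the resolvent -/

namespace JumpLR

variable {S : Type*} [Fintype S] [DecidableEq S]

/-- Exponential convergence of the semigroup with rates `r` to the mean under `π`. -/
def SemigroupDecay (r : S → S → ℝ) (π : S → ℝ) (K c : ℝ) : Prop :=
  ∀ (f : S → ℂ) (t : ℝ), 0 ≤ t → ∀ x,
    ‖semigroup r t f x - ∑ y, π y • f y‖ ≤ K * Real.exp (-c * t) * ∑ y, ‖f y‖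

variable {r : S → S → ℝ} {π : S → ℝ} {K c : ℝ}

theorem IsTransitionFamily.exists_semigroupDecay [Nonempty S] {C : ℝ}
    {p : ℝ → Matrix S S ℝ} (hr : BoundedRates (fun _ => r) C) (hC : 0 ≤ C)
    (hp : IsTransitionFamily (fun _ => r) p) (hirr : Irreducible r)
    (hπ : IsInvariantDistribution (p 1) π) :
    ∃ K c : ℝ, 0 ≤ K ∧ 0 < c ∧ SemigroupDecay r π K c := by
  obtain ⟨K, c, hK, hc, h⟩ := hp.exists_sum_abs_sub_le hr hC hirr hπ
  refine ⟨K, c, hK, hc, fun f t ht x => ?_⟩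
  rw [hp.semigroup_eq hr hC f ht, ← Finset.sum_sub_distrib, Finset.mul_sum]
  refine (norm_sum_le _ _).trans (Finset.sum_le_sum fun y _ => ?_)
  rw [← sub_smul, norm_smul, Real.norm_eq_abs]
  refine mul_le_mul_of_nonneg_right (le_trans ?_ (h t ht x)) (norm_nonneg _)
  exact Finset.single_le_sum (f := fun y => |p t x y - π y|) (fun y _ => abs_nonneg _)
    (Finset.mem_univ y)

/-- A periodic forward solution is close to the invariant distribution of nearby constant rates. -/
theorem IsForwardSolution.abs_sub_le_of_periodic (hK : 0 ≤ K) (hc : 0 < c)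
    (hdec : SemigroupDecay r π K c) {q : ℝ → S → S → ℝ} {μ : ℝ → S → ℝ} {C T η : ℝ}
    (hq : BoundedRates q C) (hC : 0 ≤ C) (hμ : IsForwardSolution q μ) (hT : 0 < T)
    (hper : ∀ t, 0 ≤ t → μ (t + T) = μ t) (hη : ∀ s x y, |q s x y - r x y| ≤ η)
    {t : ℝ} (ht : 0 ≤ t) (y : S) :
    |μ t y - π y| ≤ η * (Fintype.card S * Fintype.card S * (2 * K) / c) := by
  have hη0 : 0 ≤ η := (abs_nonneg _).trans (hη 0 y y)
  have hiter : ∀ n : ℕ, μ (t + n * T) = μ t := by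
    intro n
    induction n with
    | zero => simp
    | succ n ih =>
      rw [← ih, ← hper (t + n * T) (by positivity)]
      congr 1
      push_cast
      ring
  set B : ℝ := η * (Fintype.card S * Fintype.card S * (2 * K)) with hB
  have hB0 : 0 ≤ B := by positivity
  let f : S → ℂ := Pi.single y 1
  have hf : ∑ z, ‖f z‖ = 1 := by
    rw [Finset.sum_eq_single y] <;> simp +contextual [f]
  have hsum : ∀ m : S → ℝ, ∑ z, m z • f z = (m y : ℂ) := fun m => by
    rw [Finset.sum_eq_single y] <;> simp +contextual [f]
  have hdecf : ∀ s, 0 ≤ s → ∀ x, ‖semigroup r s f x - (π y : ℂ)‖ ≤ K * Real.exp (-c * s) := by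
    intro s hs x
    have := hdec f s hs x
    rwa [hf, mul_one, hsum] at this
  have hbound : ∀ t', 0 ≤ t' → |μ t' y - π y| ≤ K * Real.exp (-c * t') + B / c := by
    intro t' ht'
    have key := hμ.sum_smul_eq hq hC r f ht'
    rw [hsum] at key
    have h1 : ∑ x, μ 0 x • semigroup r t' f x =
        (π y : ℂ) + ∑ x, μ 0 x • (semigroup r t' f x - (π y : ℂ)) := by
      simp only [smul_sub, Finset.sum_sub_distrib]
      rw [← Finset.sum_smul, (hμ.mem 0).2, one_smul]
      ring
    have h2 : ‖∑ x, μ 0 x • (semigroup r t' f x - (π y : ℂ))‖ ≤ K * Real.exp (-c * t') := by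
      calc _ ≤ ∑ x, μ 0 x * (K * Real.exp (-c * t')) := by
            refine (norm_sum_le _ _).trans (Finset.sum_le_sum fun x _ => ?_)
            rw [norm_smul, Real.norm_of_nonneg ((hμ.mem 0).1 x)]
            exact mul_le_mul_of_nonneg_left (hdecf t' ht' x) ((hμ.mem 0).1 x)
        _ = _ := by rw [← Finset.sum_mul, (hμ.mem 0).2, one_mul]
    have hderiv : ∀ s : ℝ, HasDerivAt (fun s => B / c * Real.exp (-c * (t' - s)))
        (B * Real.exp (-c * (t' - s))) s := fun s => by
      have h := ((((hasDerivAt_id s).const_sub t').const_mul (-c)).exp).const_mul (B / c)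
      convert! h using 1
      simp only [id]
      field_simp
    have h3 : ‖∫ s in (0 : ℝ)..t', ∑ x, ∑ z, (μ s x * (q s x z - r x z)) •
        (semigroup r (t' - s) f z - semigroup r (t' - s) f x)‖ ≤ B / c := by
      calc _ ≤ ∫ s in (0 : ℝ)..t', B * Real.exp (-c * (t' - s)) := by
            refine intervalIntegral.norm_integral_le_of_norm_le ht' (ae_of_all _ fun s hs => ?_)
              (Continuous.intervalIntegrable (by fun_prop) _ _)
            have hterm : ∀ x z, ‖(μ s x * (q s x z - r x z)) •
                (semigroup r (t' - s) f z - semigroup r (t' - s) f x)‖ ≤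
                η * (2 * (K * Real.exp (-c * (t' - s)))) := fun x z => by
              rw [norm_smul, Real.norm_eq_abs, abs_mul]
              refine mul_le_mul ?_ ?_ (norm_nonneg _) hη0
              · calc |μ s x| * |q s x z - r x z| ≤ 1 * η :=
                      mul_le_mul (abs_le_one_of_mem_stdSimplex (hμ.mem s) x) (hη s x z)
                        (abs_nonneg _) zero_le_one
                  _ = η := one_mul _
              · have e : semigroup r (t' - s) f z - semigroup r (t' - s) f x =
                    (semigroup r (t' - s) f z - (π y : ℂ)) -
                      (semigroup r (t' - s) f x - (π y : ℂ)) := by ring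
                have hs' : 0 ≤ t' - s := sub_nonneg.2 hs.2
                rw [e]
                refine (norm_sub_le _ _).trans ?_
                linarith [hdecf _ hs' x, hdecf _ hs' z]
            refine (norm_sum_le_of_le _ fun x _ => norm_sum_le_of_le _ fun z _ =>
              hterm x z).trans_eq ?_
            simp only [Finset.sum_const, Finset.card_univ, nsmul_eq_mul, hB]
            ring
        _ = B / c * Real.exp (-c * (t' - t')) - B / c * Real.exp (-c * (t' - 0)) :=
            intervalIntegral.integral_eq_sub_of_hasDerivAt (fun s _ => hderiv s)
              (Continuous.intervalIntegrable (by fun_prop) _ _)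
        _ ≤ B / c := by
            rw [sub_self, mul_zero, Real.exp_zero, mul_one]
            exact sub_le_self _ (by positivity)
    have h4 : ((μ t' y - π y : ℝ) : ℂ) = ∑ x, μ 0 x • (semigroup r t' f x - (π y : ℂ)) +
        ∫ s in (0 : ℝ)..t', ∑ x, ∑ z, (μ s x * (q s x z - r x z)) •
          (semigroup r (t' - s) f z - semigroup r (t' - s) f x) := by
      rw [Complex.ofReal_sub, key, h1]
      ring
    rw [← Real.norm_eq_abs, ← Complex.norm_real, h4]
    exact (norm_add_le _ _).trans (add_le_add h2 h3)
  -- By periodicity the bound at time `t + nT` concerns `μ t` itself, and `n → ∞` removes the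
  -- contribution of the initial law.
  have hlim : Tendsto (fun n : ℕ => K * Real.exp (-c * (t + n * T)) + B / c) atTop
      (𝓝 (K * 0 + B / c)) := by
    refine Tendsto.add_const _ (Tendsto.const_mul _ (Real.tendsto_exp_atBot.comp ?_))
    refine Tendsto.const_mul_atTop_of_neg (neg_neg_of_pos hc) ?_
    exact tendsto_atTop_add_const_left _ _ (tendsto_natCast_atTop_atTop.atTop_mul_const hT)
  have hle := ge_of_tendsto' hlim fun n => by
    have := hbound (t + n * T) (by positivity)
    rwa [hiter] at this
  calc _ ≤ _ := hle
    _ = _ := by rw [hB]; ring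

section Resolvent

/-- The centred semigroup `e^{sL} f - π(f)`. -/
noncomputable def centeredSemigroup (r : S → S → ℝ) (π : S → ℝ) (f : S → ℂ) (s : ℝ) (x : S) : ℂ :=
  semigroup r s f x - ∑ y, π y • f y

/-- The function `∫_0^∞ e^{zs} (e^{sL} f - π(f)) ds`. -/
noncomputable def resolvent (r : S → S → ℝ) (π : S → ℝ) (z : ℂ) (f : S → ℂ) (x : S) : ℂ :=
  ∫ s in Set.Ioi (0 : ℝ), Complex.exp (z * s) * centeredSemigroup r π f s x

variable {z : ℂ}

theorem SemigroupDecay.norm_exp_mul_le (hdec : SemigroupDecay r π K c) (hz : z.re = 0)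
    (f : S → ℂ) {s : ℝ} (hs : 0 ≤ s) (x : S) :
    ‖Complex.exp (z * s) * centeredSemigroup r π f s x‖ ≤
      K * Real.exp (-c * s) * ∑ y, ‖f y‖ := by
  rw [norm_mul, Complex.norm_exp]
  have h0 : (z * s).re = 0 := by simp [hz]
  rw [h0, Real.exp_zero, one_mul]
  exact hdec f s hs x

theorem continuous_exp_mul_centeredSemigroup (f : S → ℂ) (x : S) :
    Continuous fun s : ℝ => Complex.exp (z * s) * centeredSemigroup r π f s x := by
  have := continuous_semigroup r f x
  unfold centeredSemigroup
  fun_prop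

theorem SemigroupDecay.integrableOn (hc : 0 < c) (hdec : SemigroupDecay r π K c) (hz : z.re = 0)
    (f : S → ℂ) (x : S) :
    IntegrableOn (fun s : ℝ => Complex.exp (z * s) * centeredSemigroup r π f s x)
      (Set.Ioi 0) := by
  have h1 : IntegrableOn (fun s : ℝ => K * Real.exp (-c * s) * ∑ y, ‖f y‖) (Set.Ioi 0) :=
    ((exp_neg_integrableOn_Ioi 0 hc).const_mul K).mul_const _
  refine Integrable.mono' h1
    (continuous_exp_mul_centeredSemigroup f x).aestronglyMeasurable ?_
  exact (ae_restrict_mem measurableSet_Ioi).mono fun s hs =>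
    hdec.norm_exp_mul_le hz f (le_of_lt hs) x

/-- Integrate the derivative of `e^{zs}(e^{sL}f - π(f))` over `[0, ∞)`. As `|e^{zs}| = 1`, the decay
at infinity comes entirely from the centring, which is harmless because `L` kills constants. -/
theorem SemigroupDecay.resolvent_equation (hc : 0 < c) (hdec : SemigroupDecay r π K c)
    (hz : z.re = 0) (f : S → ℂ) (x : S) :
    z * resolvent r π z f x + ∑ y, r x y • (resolvent r π z f y - resolvent r π z f x) =
      -(f x - ∑ y, π y • f y) := by
  have hint := hdec.integrableOn hc hz f
  let F : ℝ → S → ℂ := fun s x => Complex.exp (z * s) * centeredSemigroup r π f s x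
  have hderiv : ∀ s ∈ Set.Ici (0 : ℝ), HasDerivAt (fun s => F s x)
      (z * F s x + ∑ y, r x y • (F s y - F s x)) s := fun s _ => by
    have h1 : HasDerivAt (fun s : ℝ => Complex.exp (z * s)) (Complex.exp (z * s) * z) s := by
      simpa using (((hasDerivAt_id (s : ℂ)).const_mul z).cexp).comp_ofReal
    have h2 := h1.mul ((hasDerivAt_semigroup r f x s).sub_const (∑ y, π y • f y))
    convert! h2 using 1
    simp only [F, centeredSemigroup, ← mul_sub, sub_sub_sub_cancel_right, Finset.mul_sum,
      mul_smul_comm]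
    ring
  have hxy : ∀ y, Integrable (fun s => r x y • (F s y - F s x))
      (volume.restrict (Set.Ioi 0)) := fun y => ((hint y).sub (hint x)).smul (r x y)
  have hsum : IntegrableOn (fun s => ∑ y, r x y • (F s y - F s x)) (Set.Ioi 0) :=
    integrable_finsetSum _ fun y _ => hxy y
  have hint' : IntegrableOn (fun s => z * F s x + ∑ y, r x y • (F s y - F s x)) (Set.Ioi 0) :=
    ((hint x).const_mul z).add hsum
  have hlim : Tendsto (fun s => F s x) atTop (𝓝 0) := by
    have h0 : Tendsto (fun s : ℝ => K * Real.exp (-c * s) * ∑ y, ‖f y‖) atTop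
        (𝓝 (K * 0 * ∑ y, ‖f y‖)) :=
      ((Real.tendsto_exp_atBot.comp
        (tendsto_id.const_mul_atTop_of_neg (neg_neg_of_pos hc))).const_mul K).mul_const _
    rw [mul_zero, zero_mul] at h0
    exact squeeze_zero_norm' ((eventually_ge_atTop 0).mono fun s hs =>
      hdec.norm_exp_mul_le hz f hs x) h0
  have key := integral_Ioi_of_hasDerivAt_of_tendsto' hderiv hint' hlim
  have e1 : ∫ s in Set.Ioi (0 : ℝ), ∑ y, r x y • (F s y - F s x) =
      ∑ y, r x y • (resolvent r π z f y - resolvent r π z f x) := by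
    rw [integral_finsetSum _ fun y _ => hxy y]
    refine Finset.sum_congr rfl fun y _ => ?_
    rw [integral_smul, integral_sub (hint y) (hint x)]
    rfl
  rw [integral_add ((hint x).const_mul z) hsum, integral_const_mul, e1] at key
  simpa [F, resolvent, centeredSemigroup, semigroup_zero] using key

end Resolvent

omit [DecidableEq S] in
theorem intervalIntegrable_finsetSum {E : Type*} [NormedAddCommGroup E] {F : S → ℝ → E} {a b : ℝ}
    (h : ∀ x, IntervalIntegrable (F x) volume a b) :
    IntervalIntegrable (fun t => ∑ x, F x t) volume a b := by
  have := IntervalIntegrable.sum Finset.univ fun x _ => h x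
  rwa [show ∑ x, F x = fun t => ∑ x, F x t from funext fun t => Finset.sum_apply _ _ _] at this

/-- The Fourier coefficients of a periodic forward solution. -/
theorem IsForwardSolution.integral_exp_mul_eq (hc : 0 < c) (hdec : SemigroupDecay r π K c)
    {z : ℂ} (hz : z.re = 0) {q : ℝ → S → S → ℝ} {μ : ℝ → S → ℝ} {C T : ℝ}
    (hq : BoundedRates q C) (hC : 0 ≤ C) (hμ : IsForwardSolution q μ) (hT : 0 ≤ T)
    (hper : μ T = μ 0) (hzT : Complex.exp (z * T) = 1) (f : S → ℂ) :
    ∫ t in (0 : ℝ)..T, Complex.exp (z * t) * ∑ y, μ t y • f y =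
      (∫ t in (0 : ℝ)..T, Complex.exp (z * t) * ∑ y, π y • f y) +
      ∫ t in (0 : ℝ)..T, Complex.exp (z * t) * ∑ x, ∑ y, (μ t x * (q t x y - r x y)) •
        (resolvent r π z f y - resolvent r π z f x) := by
  set w := resolvent r π z f with hw
  have hexp : ∀ t : ℝ, HasDerivAt (fun s : ℝ => Complex.exp (z * s)) (Complex.exp (z * t) * z) t :=
    fun t => by simpa using (((hasDerivAt_id (t : ℂ)).const_mul z).cexp).comp_ofReal
  -- With the test function `e^{zt} w`, the boundary terms agree because both `μ` and `e^{zt}`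
  -- return to their initial values at `T`.
  have key := hμ.dynkin hq hC le_rfl hT (h := fun t y => Complex.exp (z * t) * w y)
    (h' := fun t y => Complex.exp (z * t) * z * w y)
    (fun y t => (hexp t).mul_const _) (fun y => by fun_prop)
  rw [hzT, hper] at key
  simp only [Complex.ofReal_zero, mul_zero, Complex.exp_zero, sub_self] at key
  have hμi : ∀ y, IntervalIntegrable (fun t => μ t y) volume 0 T := fun y =>
    intervalIntegrable_of_measurable_of_bounded (hμ.measurable y).aestronglyMeasurable
      (fun t => abs_le_one_of_mem_stdSimplex (hμ.mem t) y) _ _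
  have hcont : Continuous fun t : ℝ => Complex.exp (z * t) := by fun_prop
  have i1 : IntervalIntegrable (fun t : ℝ => Complex.exp (z * t) * ∑ y, μ t y • f y)
      volume 0 T := by
    refine IntervalIntegrable.continuousOn_mul ?_ hcont.continuousOn
    exact intervalIntegrable_finsetSum fun y =>
      (hμi y).smul_continuousOn (continuousOn_const (c := f y))
  have i2 : IntervalIntegrable (fun t : ℝ => Complex.exp (z * t) * ∑ y, π y • f y)
      volume 0 T := Continuous.intervalIntegrable (by fun_prop) _ _
  have i3 : IntervalIntegrable (fun t : ℝ => Complex.exp (z * t) *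
      ∑ x, ∑ y, (μ t x * (q t x y - r x y)) • (w y - w x)) volume 0 T := by
    refine IntervalIntegrable.continuousOn_mul ?_ hcont.continuousOn
    have hxy : ∀ x y, IntervalIntegrable (fun t => (μ t x * (q t x y - r x y)) • (w y - w x))
        volume 0 T := fun x y => by
      refine IntervalIntegrable.smul_continuousOn ?_ continuousOn_const
      refine intervalIntegrable_of_measurable_of_bounded (C := 1 * (C + |r x y|))
        ((hμ.measurable x).mul ((hq.measurable x y).sub_const _)).aestronglyMeasurable
        (fun t => ?_) _ _
      rw [Pi.mul_apply, norm_mul]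
      refine mul_le_mul (abs_le_one_of_mem_stdSimplex (hμ.mem t) x) ?_ (norm_nonneg _) zero_le_one
      exact (abs_sub _ _).trans (by gcongr; exact hq.abs_le _ _ _)
    exact intervalIntegrable_finsetSum fun x => intervalIntegrable_finsetSum fun y => hxy x y
  have hsplit : ∀ t : ℝ, ∑ x, μ t x • (Complex.exp (z * t) * z * w x) +
      ∑ x, ∑ y, (μ t x * q t x y) • (Complex.exp (z * t) * w y - Complex.exp (z * t) * w x) =
      Complex.exp (z * t) * ∑ y, π y • f y +
      Complex.exp (z * t) * (∑ x, ∑ y, (μ t x * (q t x y - r x y)) • (w y - w x)) -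
      Complex.exp (z * t) * ∑ y, μ t y • f y := by
    intro t
    have h1 : ∑ x, μ t x • (z * w x + ∑ y, r x y • (w y - w x)) =
        (∑ y, π y • f y) - ∑ y, μ t y • f y := by
      rw [Finset.sum_congr rfl fun x _ => by rw [hdec.resolvent_equation hc hz f x]]
      simp only [smul_neg, smul_sub, Finset.sum_neg_distrib, Finset.sum_sub_distrib]
      rw [← Finset.sum_smul, (hμ.mem t).2, one_smul]
      ring
    rw [← mul_add, ← mul_sub, add_sub_right_comm, ← h1]
    simp only [Finset.mul_sum, ← Finset.sum_add_distrib, smul_add, Finset.smul_sum,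
      Complex.real_smul]
    refine Finset.sum_congr rfl fun x _ => ?_
    rw [mul_add, mul_add, add_assoc, Finset.mul_sum, Finset.mul_sum, ← Finset.sum_add_distrib]
    congr 1
    · ring
    · refine Finset.sum_congr rfl fun y _ => ?_
      push_cast
      ring
  rw [intervalIntegral.integral_congr fun t _ => hsplit t,
    intervalIntegral.integral_sub (i2.add i3) i1, intervalIntegral.integral_add i2 i3] at key
  exact (sub_eq_zero.1 key.symm).symm

end JumpLR

/-! ### Perturbed rates and differentiation at zero -/

namespace JumpLR

section PerturbedRate

variable {S : Type*} {r : S → S → ℝ} {g : ℝ → S → S → ℝ} {M R : ℝ}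

theorem boundedRates_perturbedRate (hr : ∀ x y, 0 ≤ r x y) (hR : ∀ x y, r x y ≤ R)
    (hg_meas : ∀ x y, Measurable fun s => g s x y) (hM : ∀ s x y, |g s x y| ≤ M) (lam : ℝ) :
    BoundedRates (perturbedRate r g lam) (Real.exp (|lam| * M) * R) where
  measurable x y := (((hg_meas x y).const_mul lam).exp).mul_const _
  nonneg s x y := mul_nonneg (Real.exp_pos _).le (hr x y)
  le s x y := by
    refine mul_le_mul (Real.exp_le_exp.2 ?_) (hR x y) (hr x y) (Real.exp_pos _).le
    refine (le_abs_self _).trans ?_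
    rw [abs_mul]
    exact mul_le_mul_of_nonneg_left (hM s x y) (abs_nonneg _)

theorem abs_perturbedRate_sub_le (hr : ∀ x y, 0 ≤ r x y) (hR : ∀ x y, r x y ≤ R)
    (hM : ∀ s x y, |g s x y| ≤ M) {lam : ℝ} (hlam : |lam| * M ≤ 1) (s : ℝ) (x y : S) :
    |perturbedRate r g lam s x y - r x y| ≤ |lam| * (2 * M * R) := by
  have h1 : |lam * g s x y| ≤ |lam| * M := by
    rw [abs_mul]
    exact mul_le_mul_of_nonneg_left (hM s x y) (abs_nonneg _)
  have h2 := Real.abs_exp_sub_one_le (h1.trans hlam)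
  have e : perturbedRate r g lam s x y - r x y = (Real.exp (lam * g s x y) - 1) * r x y := by
    simp only [perturbedRate]; ring
  rw [e, abs_mul, abs_of_nonneg (hr x y)]
  calc _ ≤ (2 * (|lam| * M)) * R :=
        mul_le_mul (h2.trans (mul_le_mul_of_nonneg_left h1 zero_le_two)) (hR x y) (hr x y)
          (mul_nonneg zero_le_two ((abs_nonneg _).trans h1))
    _ = _ := by ring

theorem tendsto_inv_mul_perturbedRate_sub (s : ℝ) (x y : S) :
    Tendsto (fun lam => lam⁻¹ * (perturbedRate r g lam s x y - r x y)) (𝓝[≠] 0)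
      (𝓝 (r x y * g s x y)) := by
  have h : HasDerivAt (fun lam => perturbedRate r g lam s x y) (g s x y * r x y) 0 := by
    have := (((hasDerivAt_id (0 : ℝ)).mul_const (g s x y)).exp).mul_const (r x y)
    simpa [perturbedRate] using this
  have h2 := hasDerivAt_iff_tendsto_slope.1 h
  rw [mul_comm]
  refine h2.congr fun lam => ?_
  simp [slope, perturbedRate_zero]

end PerturbedRate

variable {S : Type*} [Fintype S] [DecidableEq S] {r : S → S → ℝ} {g : ℝ → S → S → ℝ}
  {π : S → ℝ} {K c M R T : ℝ}

/-- Continuity of the steady state at `λ = 0`, the only regularity in `λ` that the derivative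
requires of it. -/
theorem tendsto_periodic_forwardSolution (hK : 0 ≤ K) (hc : 0 < c)
    (hdec : SemigroupDecay r π K c) (hr : ∀ x y, 0 ≤ r x y) (hR0 : 0 ≤ R)
    (hR : ∀ x y, r x y ≤ R) (hg_meas : ∀ x y, Measurable fun s => g s x y)
    (hM : ∀ s x y, |g s x y| ≤ M) {μ : ℝ → ℝ → S → ℝ}
    (hμ : ∀ lam, IsForwardSolution (perturbedRate r g lam) (μ lam)) (hT : 0 < T)
    (hper : ∀ lam t, 0 ≤ t → μ lam (t + T) = μ lam t) {t : ℝ} (ht : 0 ≤ t) (y : S) :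
    Tendsto (fun lam => μ lam t y) (𝓝[≠] 0) (𝓝 (π y)) := by
  rw [tendsto_iff_norm_sub_tendsto_zero]
  have hlim : Tendsto (fun lam : ℝ => |lam| * (2 * M * R) *
      (Fintype.card S * Fintype.card S * (2 * K) / c)) (𝓝[≠] 0) (𝓝 0) := by
    have : Continuous fun lam : ℝ => |lam| * (2 * M * R) *
      (Fintype.card S * Fintype.card S * (2 * K) / c) := by fun_prop
    simpa using (this.tendsto 0).mono_left nhdsWithin_le_nhds
  have hsmall : ∀ᶠ lam : ℝ in 𝓝[≠] 0, |lam| * M ≤ 1 := by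
    have : Continuous fun lam : ℝ => |lam| * M := by fun_prop
    refine (this.tendsto 0).mono_left nhdsWithin_le_nhds |>.eventually_le_const ?_
    simp
  refine squeeze_zero' (Eventually.of_forall fun _ => norm_nonneg _)
    (hsmall.mono fun lam hlam => ?_) hlim
  exact (hμ lam).abs_sub_le_of_periodic hK hc hdec
    (boundedRates_perturbedRate hr hR hg_meas hM lam) (by positivity) hT (hper lam)
    (abs_perturbedRate_sub_le hr hR hM hlam) ht y

/-- Linear response of the Fourier coefficients of periodic forward solutions. -/
theorem hasDerivAt_integral_exp_mul (hK : 0 ≤ K) (hc : 0 < c)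
    (hdec : SemigroupDecay r π K c) (hr : ∀ x y, 0 ≤ r x y) (hR0 : 0 ≤ R)
    (hR : ∀ x y, r x y ≤ R) (hg_meas : ∀ x y, Measurable fun s => g s x y)
    (hM : ∀ s x y, |g s x y| ≤ M) {μ : ℝ → ℝ → S → ℝ}
    (hμ : ∀ lam, IsForwardSolution (perturbedRate r g lam) (μ lam)) (hT : 0 < T)
    (hper : ∀ lam t, 0 ≤ t → μ lam (t + T) = μ lam t) {z : ℂ} (hz : z.re = 0)
    (hzT : Complex.exp (z * T) = 1) (f : S → ℂ) :
    HasDerivAt (fun lam => ∫ t in (0 : ℝ)..T, Complex.exp (z * t) * ∑ y, μ lam t y • f y)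
      (∫ t in (0 : ℝ)..T, Complex.exp (z * t) * ∑ x, ∑ y, (π x * (r x y * g t x y)) •
        (resolvent r π z f y - resolvent r π z f x)) 0 := by
  set w := resolvent r π z f with hw
  have hq := boundedRates_perturbedRate hr hR hg_meas hM
  have hid := fun lam => (hμ lam).integral_exp_mul_eq hc hdec hz (hq lam) (by positivity) hT.le
    (by simpa using hper lam 0 le_rfl) hzT f
  -- The exact identities at `lam` and at `0` share the `π` term, and the correction vanishes at
  -- `0`; hence the difference quotient falls only on the rates.
  have hslope : ∀ lam, slope (fun lam => ∫ t in (0 : ℝ)..T,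
      Complex.exp (z * t) * ∑ y, μ lam t y • f y) 0 lam =
      ∫ t in (0 : ℝ)..T, Complex.exp (z * t) * ∑ x, ∑ y,
        (μ lam t x * (lam⁻¹ * (perturbedRate r g lam t x y - r x y))) • (w y - w x) := by
    intro lam
    rw [slope, hid lam, hid 0, vsub_eq_sub]
    simp only [perturbedRate_zero, sub_self, mul_zero, zero_smul, Finset.sum_const_zero,
      intervalIntegral.integral_zero, add_zero, sub_zero, add_sub_cancel_left, ← hw]
    rw [← intervalIntegral.integral_smul]
    refine intervalIntegral.integral_congr fun t _ => ?_
    simp only [← mul_smul_comm, Finset.smul_sum, smul_smul]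
    congr 1
    refine Finset.sum_congr rfl fun x _ => Finset.sum_congr rfl fun y _ => ?_
    congr 1
    ring
  rw [hasDerivAt_iff_tendsto_slope, funext hslope]
  have hsmall : ∀ᶠ lam : ℝ in 𝓝[≠] 0, |lam| * M ≤ 1 := by
    have : Continuous fun lam : ℝ => |lam| * M := by fun_prop
    refine (this.tendsto 0).mono_left nhdsWithin_le_nhds |>.eventually_le_const ?_
    simp
  -- Near `0` the quotients of the rates are bounded by `2 * M * R`, and `μ lam` takes values in
  -- `[0, 1]`, so a constant dominates.
  refine intervalIntegral.tendsto_integral_filter_of_dominated_convergence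
    (fun _ => ∑ x, ∑ y, (2 * M * R) * ‖w y - w x‖) ?_ ?_ intervalIntegrable_const ?_
  · refine Eventually.of_forall fun lam => Measurable.aestronglyMeasurable ?_
    refine Measurable.mul (by fun_prop) ?_
    refine Finset.measurable_fun_sum _ fun x _ => Finset.measurable_fun_sum _ fun y _ => ?_
    exact (((hμ lam).measurable x).mul ((((hq lam).measurable x y).sub_const _).const_mul _)).smul_const
      _
  · filter_upwards [hsmall, self_mem_nhdsWithin] with lam hlam hne
    refine ae_of_all _ fun t _ => ?_
    have hexp : ‖Complex.exp (z * t)‖ = 1 := by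
      rw [Complex.norm_exp]; simp [hz]
    rw [norm_mul, hexp, one_mul]
    refine norm_sum_le_of_le _ fun x _ => norm_sum_le_of_le _ fun y _ => ?_
    rw [norm_smul]
    refine mul_le_mul_of_nonneg_right ?_ (norm_nonneg _)
    rw [Real.norm_eq_abs, abs_mul, abs_mul, abs_inv]
    have h1 := abs_perturbedRate_sub_le hr hR hM hlam t x y
    have h2 : 0 < |lam| := abs_pos.2 hne
    have h3 : |lam|⁻¹ * |perturbedRate r g lam t x y - r x y| ≤ 2 * M * R := by
      rw [inv_mul_le_iff₀ h2]
      exact h1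
    calc _ ≤ 1 * (2 * M * R) := mul_le_mul
          (abs_le_one_of_mem_stdSimplex ((hμ lam).mem t) x) h3 (by positivity) zero_le_one
      _ = _ := one_mul _
  · refine ae_of_all _ fun t ht => ?_
    rw [Set.uIoc_of_le hT.le] at ht
    refine Tendsto.const_mul _ (tendsto_finsetSum _ fun x _ => tendsto_finsetSum _ fun y _ => ?_)
    exact ((tendsto_periodic_forwardSolution hK hc hdec hr hR0 hR hg_meas hM hμ hT hper ht.1.le x).mul
      (tendsto_inv_mul_perturbedRate_sub t x y)).smul_const _

end JumpLR

/-! ### From the martingale problem to the forward equation -/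

namespace JumpLR

variable {S : Type*} [Fintype S] [MeasurableSpace S] [DiscreteMeasurableSpace S]
  {Ω : Type*} [MeasurableSpace Ω]

omit [Fintype S] in
/-- Joint measurability of a right-continuous process with discrete state space. -/
theorem measurable_uncurry_of_rightContinuous {X : ℝ≥0 → Ω → S} (hX : ∀ t, Measurable (X t))
    (hrc : ∀ ω t, ∀ᶠ s in 𝓝[≥] t, X s ω = X t ω) (h : S → ℝ) :
    Measurable fun z : ℝ × Ω => h (X z.1.toNNReal z.2) := by
  -- The next point of the grid of mesh `1/(n+1)` to the right of `s`: each approximation uses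
  -- countably many times, and right continuity makes it eventually equal to the value at `s`.
  let a : ℕ → ℝ → ℝ := fun n s => ((⌊((n : ℝ) + 1) * s⌋ : ℝ) + 1) / ((n : ℝ) + 1)
  refine measurable_of_tendsto_metrizable
    (f := fun n (z : ℝ × Ω) => h (X (a n z.1).toNNReal z.2)) (fun n => ?_) ?_
  · let G : ℤ × Ω → ℝ := fun z => h (X (((z.1 : ℝ) + 1) / ((n : ℝ) + 1)).toNNReal z.2)
    have hG : Measurable G := measurable_from_prod_countable_right fun m =>
      (Measurable.of_discrete (f := h)).comp
        (hX (((m : ℝ) + 1) / ((n : ℝ) + 1)).toNNReal)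
    have hfl : Measurable fun z : ℝ × Ω => (⌊((n : ℝ) + 1) * z.1⌋, z.2) :=
      (Int.measurable_floor.comp (measurable_fst.const_mul _)).prodMk measurable_snd
    exact hG.comp hfl
  · rw [tendsto_pi_nhds]
    rintro ⟨s, ω⟩
    have hlow : ∀ n, s ≤ a n s := fun n => by
      rw [le_div_iff₀ (by positivity), mul_comm]
      exact (Int.lt_floor_add_one _).le
    have hup : ∀ n, a n s ≤ s + 1 / ((n : ℝ) + 1) := fun n => by
      have hn : (0 : ℝ) < (n : ℝ) + 1 := by positivity
      have e : (s + 1 / ((n : ℝ) + 1)) * ((n : ℝ) + 1) = ((n : ℝ) + 1) * s + 1 := by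
        field_simp
      rw [div_le_iff₀ hn, e]
      exact add_le_add_left (Int.floor_le _) 1
    have hlim : Tendsto (fun n => a n s) atTop (𝓝 s) := by
      refine tendsto_of_tendsto_of_tendsto_of_le_of_le tendsto_const_nhds ?_ hlow hup
      simpa using tendsto_const_nhds.add (tendsto_one_div_add_atTop_nhds_zero_nat (𝕜 := ℝ))
    have hlim' : Tendsto (fun n => (a n s).toNNReal) atTop (𝓝[≥] s.toNNReal) :=
      tendsto_nhdsWithin_iff.2 ⟨(continuous_real_toNNReal.tendsto s).comp hlim,
        Eventually.of_forall fun n => Real.toNNReal_le_toNNReal (hlow n)⟩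
    refine tendsto_const_nhds.congr' ?_
    filter_upwards [hlim'.eventually (hrc ω s.toNNReal)] with n hn
    simp only [hn]

variable [DecidableEq S]

omit [MeasurableSpace S] [DiscreteMeasurableSpace S] in
theorem sum_mul_jumpGenerator_single (q : S → S → ℝ) (m : S → ℝ) (y : S) :
    ∑ x, m x * jumpGenerator q (Pi.single y 1) x = netFlow q m y := by
  have h := sum_netFlow_smul q m (Pi.single y (1 : ℝ))
  rw [Finset.sum_eq_single y (by simp +contextual) (by simp)] at h
  simp only [Pi.single_eq_same, smul_eq_mul, mul_one] at h
  rw [h]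
  simp only [jumpGenerator, Finset.mul_sum, mul_assoc]

omit [MeasurableSpace S] [DiscreteMeasurableSpace S] in
theorem BoundedRates.abs_jumpGenerator_single_le {q : ℝ → S → S → ℝ} {C : ℝ}
    (hq : BoundedRates q C) (s : ℝ) (x y : S) :
    |jumpGenerator (q s) (Pi.single y 1) x| ≤ Fintype.card S * C := by
  have h : ∀ w, |q s x w * ((Pi.single y 1 : S → ℝ) w - (Pi.single y 1 : S → ℝ) x)| ≤ C := by
    intro w
    rw [abs_mul, ← mul_one C]
    refine mul_le_mul (hq.abs_le s x w) ?_ (abs_nonneg _) ((hq.nonneg s x w).trans (hq.le s x w))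
    simp only [Pi.single_apply]
    split_ifs <;> simp
  refine (Finset.abs_sum_le_sum_abs _ _).trans ((Finset.sum_le_sum fun w _ => h w).trans_eq ?_)
  simp

omit [DecidableEq S] in
theorem integral_comp_eq_sum (P : Measure Ω) [IsFiniteMeasure P] {Y : Ω → S} (hY : Measurable Y)
    {E : Type*} [NormedAddCommGroup E] [NormedSpace ℝ E] [CompleteSpace E] (h : S → E) :
    ∫ ω, h (Y ω) ∂P = ∑ y, P.real {ω | Y ω = y} • h y := by
  rw [← integral_map (φ := Y) (f := h) hY.aemeasurable
    (Integrable.of_finite (μ := P.map Y) (f := h)).aestronglyMeasurable, integral_fintype]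
  · refine Finset.sum_congr rfl fun y _ => ?_
    rw [map_measureReal_apply hY (measurableSet_singleton y)]
    rfl
  · exact Integrable.of_finite

theorem integral_single_comp (P : Measure Ω) [IsFiniteMeasure P] {Y : Ω → S} (hY : Measurable Y)
    (y : S) : ∫ ω, (Pi.single y 1 : S → ℝ) (Y ω) ∂P = P.real {ω | Y ω = y} := by
  rw [integral_comp_eq_sum P hY (Pi.single y (1 : ℝ)),
    Finset.sum_eq_single y (by simp +contextual) (by simp)]
  simp

namespace IsMarkovJumpProcess

variable {q : ℝ → S → S → ℝ} {C : ℝ} {x₀ : S} {P : Measure Ω} {X : ℝ≥0 → Ω → S}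

theorem measurable_real (hX : IsMarkovJumpProcess q x₀ P X) (y : S) :
    Measurable fun t : ℝ => P.real {ω | X t.toNNReal ω = y} := by
  have := hX.isProbabilityMeasure
  have h := measurable_uncurry_of_rightContinuous hX.measurable hX.rightContinuous
    (Pi.single y 1)
  have h2 := h.stronglyMeasurable.integral_prod_right' (ν := P)
  convert! h2.measurable using 1
  funext t
  exact (integral_single_comp P (hX.measurable t.toNNReal) y).symm

omit [DecidableEq S] in
theorem mem_stdSimplex (hX : IsMarkovJumpProcess q x₀ P X) (t : ℝ≥0) :
    (fun y => P.real {ω | X t ω = y}) ∈ stdSimplex ℝ S := by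
  have := hX.isProbabilityMeasure
  refine ⟨fun y => measureReal_nonneg, ?_⟩
  have := integral_comp_eq_sum P (hX.measurable t) fun _ => (1 : ℝ)
  simpa using this.symm

theorem real_zero (hX : IsMarkovJumpProcess q x₀ P X) (y : S) :
    P.real {ω | X 0 ω = y} = (1 : Matrix S S ℝ) x₀ y := by
  have := hX.isProbabilityMeasure
  rw [← integral_single_comp P (hX.measurable 0) y, integral_congr_ae (hX.start.mono fun ω hω => by
    rw [hω])]
  simp [Matrix.one_apply, Pi.single_apply]

/-- The martingale of the indicator of `y` vanishes at time `0`, so its expectation at time `t` is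
zero; Fubini moves the expectation inside the time integral. The martingale problem enters the proof
only here. -/
theorem isForwardSolution (hq : BoundedRates q C) (hX : IsMarkovJumpProcess q x₀ P X) :
    IsForwardSolution q fun t y => P.real {ω | X t.toNNReal ω = y} where
  mem t := hX.mem_stdSimplex _
  measurable y := hX.measurable_real y
  eq_integral t ht y := by
    have := hX.isProbabilityMeasure
    obtain ⟨ℱ, -, hmart⟩ := hX.martingaleProblem
    have hM := hmart (Pi.single y 1)
    have hE := hM.setIntegral_eq (zero_le (a := t.toNNReal)) MeasurableSet.univ
    simp only [setIntegral_univ, NNReal.coe_zero, intervalIntegral.integral_same, sub_self,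
      integral_zero] at hE
    have hcoe : ((t.toNNReal : ℝ≥0) : ℝ) = t := Real.coe_toNNReal t ht
    rw [hcoe] at hE
    have hf : ∀ s : ℝ≥0, Integrable (fun ω => (Pi.single y 1 : S → ℝ) (X s ω)) P := fun s =>
      (Integrable.of_finite (μ := P.map (X s)) (f := (Pi.single y 1 : S → ℝ))).comp_measurable
        (hX.measurable s)
    have hEf := fun s : ℝ≥0 => integral_single_comp P (hX.measurable s) y
    let k : Ω → ℝ → ℝ := fun ω s => jumpGenerator (q s) (Pi.single y 1) (X s.toNNReal ω)
    have hk_meas : Measurable fun z : Ω × ℝ => k z.1 z.2 := by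
      -- Splitting over the finitely many states separates the process from the time-dependent
      -- rates, which gives joint measurability.
      have e : ∀ z : Ω × ℝ, k z.1 z.2 = ∑ x, (Pi.single x 1 : S → ℝ) (X z.2.toNNReal z.1) *
          jumpGenerator (q z.2) (Pi.single y 1) x := fun z => by
        rw [Finset.sum_eq_single (X z.2.toNNReal z.1)]
        · simp [k]
        · intro x _ hx
          rw [Pi.single_eq_of_ne (Ne.symm hx), zero_mul]
        · simp
      simp only [e]
      refine Finset.measurable_fun_sum _ fun x _ => Measurable.mul ?_ ?_
      · exact (measurable_uncurry_of_rightContinuous hX.measurable hX.rightContinuous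
          (Pi.single x 1)).comp measurable_swap
      · exact Finset.measurable_fun_sum _ fun w _ =>
          ((hq.measurable x w).comp measurable_snd).mul_const _
    have hk_int : Integrable (Function.uncurry k) (P.prod (volume.restrict (Set.Ioc 0 t))) :=
      Integrable.of_bound hk_meas.aestronglyMeasurable (Fintype.card S * C)
        (ae_of_all _ fun z => hq.abs_jumpGenerator_single_le _ _ _)
    have hswap := integral_integral_swap hk_int
    have hIk : Integrable (fun ω => ∫ s in (0 : ℝ)..t, k ω s) P := by
      simp only [intervalIntegral.integral_of_le ht]
      exact hk_int.integral_prod_left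
    have hEk : ∫ ω, (∫ s in (0 : ℝ)..t, k ω s) ∂P = ∫ s in (0 : ℝ)..t,
        netFlow (q s) (fun x => P.real {ω | X s.toNNReal ω = x}) y := by
      simp only [intervalIntegral.integral_of_le ht]
      rw [hswap]
      refine integral_congr_ae (ae_of_all _ fun s => ?_)
      simp only [k]
      rw [integral_comp_eq_sum P (hX.measurable _) (jumpGenerator (q s) (Pi.single y 1)),
        ← sum_mul_jumpGenerator_single]
      simp only [smul_eq_mul]
    have e1 := integral_sub ((hf t.toNNReal).sub (hf 0)) hIk
    simp only [Pi.sub_apply] at e1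
    rw [integral_sub (hf _) (hf _), hEf, hEf, hEk] at e1
    have e2 := hE.trans e1
    simp only [Real.toNNReal_zero]
    linarith

end IsMarkovJumpProcess

/-- The one-time marginals of a family of Markov jump processes are a transition family. -/
theorem isTransitionFamily_transitionMatrix {q : ℝ → S → S → ℝ} {C : ℝ} (hq : BoundedRates q C)
    {P : S → Measure Ω} {X : ℝ≥0 → Ω → S} (hX : ∀ x, IsMarkovJumpProcess q x (P x) X) :
    IsTransitionFamily q fun t => transitionMatrix P X t.toNNReal where
  isForwardSolution x := (hX x).isForwardSolution hq
  zero := by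
    ext x y
    simpa [transitionMatrix] using (hX x).real_zero y

omit [MeasurableSpace S] [DiscreteMeasurableSpace S] [DecidableEq S] in
theorem integral_lawFrom {P : S → Measure Ω} {m : S → ℝ} (hm : ∀ x, 0 ≤ m x)
    {E : Type*} [NormedAddCommGroup E] [NormedSpace ℝ E] {F : Ω → E}
    (hF : ∀ x, Integrable F (P x)) :
    ∫ ω, F ω ∂(lawFrom P m) = ∑ x, m x • ∫ ω, F ω ∂(P x) := by
  rw [lawFrom, integral_finsetSum_measure fun x _ => (hF x).smul_measure ENNReal.ofReal_ne_top]
  refine Finset.sum_congr rfl fun x _ => ?_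
  rw [integral_smul_measure, ENNReal.toReal_ofReal (hm x)]

omit [DecidableEq S] in
theorem meanObservable_eq {q : ℝ → S → S → ℝ} {P : S → Measure Ω} {X : ℝ≥0 → Ω → S}
    (hX : ∀ x, IsMarkovJumpProcess q x (P x) X) {m : S → ℝ} (hm : ∀ x, 0 ≤ m x) (v : S → ℝ)
    (t : ℝ≥0) : meanObservable P X m v t =
      ∑ y, Matrix.vecMul m (transitionMatrix P X t) y * v y := by
  have := fun x => (hX x).isProbabilityMeasure
  have hint : ∀ x, Integrable (fun ω => v (X t ω)) (P x) := fun x =>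
    (Integrable.of_finite (μ := (P x).map (X t)) (f := v)).comp_measurable ((hX x).measurable t)
  rw [meanObservable, integral_lawFrom hm hint]
  simp only [Matrix.vecMul, dotProduct, Finset.sum_mul]
  rw [Finset.sum_comm]
  refine Finset.sum_congr rfl fun x _ => ?_
  rw [integral_comp_eq_sum (P x) ((hX x).measurable t) v, Finset.smul_sum]
  simp [transitionMatrix, mul_assoc]

end JumpLR

/-! ### Fourier coefficients and the pairing with `psiHat` -/

namespace JumpLR

variable {S : Type*} [Fintype S] {r : S → S → ℝ} {g : ℝ → S → S → ℝ} {π : S → ℝ} {T : ℝ} {k : ℤ}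

/-- The exponent `-ikω`, `ω = 2π / T`. -/
noncomputable def fourierExponent (T : ℝ) (k : ℤ) : ℂ :=
  -Complex.I * k * ((2 * Real.pi / T : ℝ) : ℂ)

theorem fourierExponent_re (T : ℝ) (k : ℤ) : (fourierExponent T k).re = 0 := by
  have : fourierExponent T k = ((-(k * (2 * Real.pi / T)) : ℝ) : ℂ) * Complex.I := by
    rw [fourierExponent]; push_cast; ring
  rw [this, Complex.re_ofReal_mul, Complex.I_re, mul_zero]

theorem exp_fourierExponent_mul (hT : 0 < T) (k : ℤ) :
    Complex.exp (fourierExponent T k * T) = 1 := by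
  have hT' : (T : ℂ) ≠ 0 := Complex.ofReal_ne_zero.2 hT.ne'
  refine Complex.exp_eq_one_iff.2 ⟨-k, ?_⟩
  rw [fourierExponent]
  push_cast
  field_simp

/-- The rates `r g` are the `λ`-derivative of the perturbed rates at `0`, so `π ψ_t` is the
first-order source term in the forward equation. -/
theorem mul_psi_eq (hπ : ∀ x, 0 < π x) (t : ℝ) (x : S) :
    π x * psi r g π t x = netFlow (fun a b => r a b * g t a b) π x := by
  have := (hπ x).ne'
  simp only [psi, netFlow, reversedRate, Finset.mul_sum]
  refine Finset.sum_congr rfl fun y _ => ?_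
  field_simp

/-- Pairing of `ψ̂_k` with a function `W` in `L²(π)`. -/
theorem sum_mul_psiHat_mul {M : ℝ} (hπ : ∀ x, 0 < π x)
    (hg_meas : ∀ x y, Measurable fun s => g s x y) (hM : ∀ s x y, |g s x y| ≤ M) (W : S → ℂ) :
    ∑ x, (π x * psiHat r g π T k x) * W x = (1 / (T : ℂ)) *
      ∫ t in (0 : ℝ)..T, Complex.exp (fourierExponent T k * t) *
        ∑ x, ∑ y, (π x * (r x y * g t x y)) • (W y - W x) := by
  have hint : ∀ x, IntervalIntegrable (fun t => Complex.exp (fourierExponent T k * t) *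
      (psi r g π t x : ℂ)) volume 0 T := fun x => by
    refine IntervalIntegrable.continuousOn_mul ?_ (Continuous.continuousOn (by fun_prop))
    have h : IntervalIntegrable (fun t => psi r g π t x) volume 0 T := by
      refine intervalIntegrable_finsetSum fun y => IntervalIntegrable.sub ?_ ?_ <;>
      exact (intervalIntegrable_of_measurable_of_bounded (hg_meas _ _).aestronglyMeasurable
        (fun t => hM t _ _) _ _).const_mul _
    exact ⟨h.1.ofReal, h.2.ofReal⟩
  have e : ∀ t : ℝ, Complex.exp (fourierExponent T k * t) *
      ∑ x, ∑ y, (π x * (r x y * g t x y)) • (W y - W x) =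
      ∑ x, (π x * W x) * (Complex.exp (fourierExponent T k * t) * (psi r g π t x : ℂ)) := fun t => by
    rw [← sum_netFlow_smul (fun a b => r a b * g t a b) π W, Finset.mul_sum]
    refine Finset.sum_congr rfl fun x _ => ?_
    rw [← mul_psi_eq hπ, Complex.real_smul]
    push_cast
    ring
  simp only [e]
  rw [intervalIntegral.integral_finsetSum fun x _ => (hint x).const_mul _, Finset.mul_sum]
  refine Finset.sum_congr rfl fun x _ => ?_
  rw [intervalIntegral.integral_const_mul, psiHat, fourierCoefficient]
  simp only [fourierExponent]
  ring

/-- Net flow conserves mass (the test function is `1`). Because of this, constants can be subtracted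
from the semigroup in the pairing, which makes the integrals over `(0, ∞)` converge. -/
theorem sum_mul_psiHat {M : ℝ} (hπ : ∀ x, 0 < π x)
    (hg_meas : ∀ x y, Measurable fun s => g s x y) (hM : ∀ s x y, |g s x y| ≤ M) :
    ∑ x, (π x * psiHat r g π T k x) = 0 := by
  simpa using sum_mul_psiHat_mul (r := r) (T := T) (k := k) hπ hg_meas hM fun _ => 1

theorem sum_mul_psiHat_mul_sub {M : ℝ} (hπ : ∀ x, 0 < π x)
    (hg_meas : ∀ x y, Measurable fun s => g s x y) (hM : ∀ s x y, |g s x y| ≤ M) (W : S → ℂ)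
    (a b : ℂ) : ∑ x, (π x * psiHat r g π T k x) * (a * (W x - b)) =
      a * ∑ x, (π x * psiHat r g π T k x) * W x := by
  have h := sum_mul_psiHat (r := r) (T := T) (k := k) hπ hg_meas hM
  have e : ∀ x, (π x * psiHat r g π T k x) * (a * (W x - b)) =
      a * ((π x * psiHat r g π T k x) * W x) - (a * b) * (π x * psiHat r g π T k x) :=
    fun x => by ring
  simp only [e, Finset.sum_sub_distrib, ← Finset.mul_sum, h, mul_zero, sub_zero]

variable [DecidableEq S]

/-- The scalar product is antilinear in its first entry, so conjugation turns `e^{ikωs}` into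
`e^{-ikωs}`, while the semigroup applied to the real `v` is real. `correlation_eq` has the same
right-hand side. -/
theorem semigroupPairing_eq {C M : ℝ} {p : ℝ → Matrix S S ℝ}
    (hr : BoundedRates (fun _ => r) C) (hC : 0 ≤ C) (hp : IsTransitionFamily (fun _ => r) p)
    (hπ : ∀ x, 0 < π x) (hg_meas : ∀ x y, Measurable fun s => g s x y)
    (hM : ∀ s x y, |g s x y| ≤ M) (v : S → ℝ) {s : ℝ} (hs : 0 ≤ s) :
    semigroupPairing r g π T k v s = ∑ x, (π x * psiHat r g π T k x) *
      (Complex.exp (fourierExponent T k * s) *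
        centeredSemigroup r π (fun x => (v x : ℂ)) s x) := by
  simp only [centeredSemigroup]
  rw [sum_mul_psiHat_mul_sub hπ hg_meas hM, semigroupPairing, exp_smul_add_smul_one_mulVec,
    innerPi, Finset.mul_sum]
  refine Finset.sum_congr rfl fun x _ => ?_
  rw [Pi.smul_apply, smul_eq_mul, hp.semigroup_eq hr hC _ hs x, map_mul, ← Complex.exp_conj]
  have h1 : (starRingEnd ℂ) (Complex.I * k * ((2 * Real.pi / T : ℝ) : ℂ) * s) =
      fourierExponent T k * s := by
    simp only [map_mul, Complex.conj_I, Complex.conj_ofReal, fourierExponent, map_intCast]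
  have h2 : (starRingEnd ℂ) (∑ y, p s x y • (v y : ℂ)) = ∑ y, p s x y • (v y : ℂ) := by
    simp [map_sum]
  rw [h1, h2]
  ring

theorem correlation_eq {C M : ℝ} [MeasurableSpace S] [DiscreteMeasurableSpace S]
    {Ω : Type*} [MeasurableSpace Ω] {P : S → Measure Ω} {X : ℝ≥0 → Ω → S}
    (hr : BoundedRates (fun _ => r) C) (hC : 0 ≤ C)
    (hX : ∀ x, IsMarkovJumpProcess (fun _ => r) x (P x) X)
    (hπ : ∀ x, 0 < π x) (hg_meas : ∀ x y, Measurable fun s => g s x y)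
    (hM : ∀ s x y, |g s x y| ≤ M) (v : S → ℝ) {s : ℝ} (hs : 0 ≤ s) :
    correlation P X r g π T k v s = ∑ x, (π x * psiHat r g π T k x) *
      (Complex.exp (fourierExponent T k * s) *
        centeredSemigroup r π (fun x => (v x : ℂ)) s x) := by
  have := fun x => (hX x).isProbabilityMeasure
  have hp := isTransitionFamily_transitionMatrix hr hX
  simp only [centeredSemigroup]
  rw [sum_mul_psiHat_mul_sub hπ hg_meas hM, correlation, integral_lawFrom fun x => (hπ x).le]
  · rw [fourierExponent]
    congr 1
    refine Finset.sum_congr rfl fun x _ => ?_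
    have h1 : ∫ ω, (v (X s.toNNReal ω) : ℂ) * psiHat r g π T k (X 0 ω) ∂(P x) =
        ∫ ω, (v (X s.toNNReal ω) : ℂ) * psiHat r g π T k x ∂(P x) :=
      integral_congr_ae ((hX x).start.mono fun ω hω => by simp only [hω])
    rw [h1, integral_mul_const, integral_comp_eq_sum (P x) ((hX x).measurable _)
      (fun y => (v y : ℂ)), hp.semigroup_eq hr hC _ hs x, Complex.real_smul]
    simp only [transitionMatrix, Matrix.of_apply]
    ring
  · intro x
    have hpair : Measurable fun ω => (X s.toNNReal ω, X 0 ω) :=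
      ((hX x).measurable _).prodMk ((hX x).measurable _)
    exact (Integrable.of_finite (μ := (P x).map fun ω => (X s.toNNReal ω, X 0 ω))
      (f := fun a : S × S => (v a.1 : ℂ) * psiHat r g π T k a.2)).comp_measurable hpair

theorem integral_sum_mul_exp_mul {K c : ℝ} (hc : 0 < c) (hdec : SemigroupDecay r π K c) {z : ℂ}
    (hz : z.re = 0) (a f : S → ℂ) :
    IntegrableOn (fun s : ℝ => ∑ x, a x * (Complex.exp (z * s) * centeredSemigroup r π f s x))
      (Set.Ioi 0) ∧
    ∫ s in Set.Ioi (0 : ℝ), ∑ x, a x * (Complex.exp (z * s) * centeredSemigroup r π f s x) =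
      ∑ x, a x * resolvent r π z f x := by
  have hint : ∀ x, Integrable (fun s : ℝ => a x * (Complex.exp (z * s) *
      centeredSemigroup r π f s x)) (volume.restrict (Set.Ioi 0)) := fun x =>
    (hdec.integrableOn hc hz f x).const_mul (a x)
  refine ⟨integrable_finsetSum _ fun x _ => hint x, ?_⟩
  rw [integral_finsetSum _ fun x _ => hint x]
  simp only [integral_const_mul, resolvent]

/-- The matrices at times `1` and `t` commute on `π`, so `π p_t` is again invariant for `p 1` and
equals `π` by uniqueness. -/
theorem IsTransitionFamily.isInvariantDistribution_of_one [Nonempty S] {C : ℝ}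
    {p : ℝ → Matrix S S ℝ} (hr : BoundedRates (fun _ => r) C) (hC : 0 ≤ C)
    (hp : IsTransitionFamily (fun _ => r) p) (hpos : ∀ x y, 0 < p 1 x y)
    (hπ : IsInvariantDistribution (p 1) π) {t : ℝ} (ht : 0 ≤ t) :
    IsInvariantDistribution (p t) π := by
  have hmem := (IsForwardSolution.mix hr hC hp.isForwardSolution hπ.1).mem t
  refine ⟨hπ.1, ?_⟩
  refine IsInvariantDistribution.eq (hp.mem 1) hpos ⟨hmem, ?_⟩ hπ
  rw [← hp.vecMul_add hr hC ht (fun _ => rfl) hπ.1 zero_le_one, add_comm,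
    hp.vecMul_add hr hC zero_le_one (fun _ => rfl) hπ.1 ht, hπ.2]

end JumpLR

/-! ### The main theorem -/

theorem mainTheorem8 {S : Type*} [Fintype S] [DecidableEq S] [Nonempty S]
    [MeasurableSpace S] [DiscreteMeasurableSpace S]
    (r : S → S → ℝ) (hr : ∀ x y, 0 ≤ r x y) (hirr : JumpLR.Irreducible r)
    (T : ℝ) (hT : 0 < T)
    (g : ℝ → S → S → ℝ) (hg_per : ∀ x y, Function.Periodic (fun s => g s x y) T)
    (hg_meas : ∀ x y, Measurable (fun s => g s x y))
    (hg_bdd : ∃ M : ℝ, ∀ s x y, |g s x y| ≤ M)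
    -- for each `lam`, the perturbed process `X lam` and its laws `P lam x`, started at `x`;
    -- `lam = 0` is the unperturbed process
    {Ω : ℝ → Type*} [∀ lam, MeasurableSpace (Ω lam)]
    (X : ∀ lam, ℝ≥0 → Ω lam → S) (P : ∀ lam, S → Measure (Ω lam))
    (hX : ∀ lam x, JumpLR.IsMarkovJumpProcess (JumpLR.perturbedRate r g lam) x
      (P lam x) (X lam)) :
    -- existence and uniqueness of the invariant distribution `π` of the unperturbed process
    (∃! π : S → ℝ, ∀ t : ℝ≥0,
      JumpLR.IsInvariantDistribution (JumpLR.transitionMatrix (P 0) (X 0) t) π) ∧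
    -- existence and uniqueness of the invariant distribution `π_lam` of `(X lam (n T))_n`
    (∀ lam : ℝ, ∃! π : S → ℝ, JumpLR.IsInvariantDistribution
      (JumpLR.transitionMatrix (P lam) (X lam) T.toNNReal) π) ∧
    ∀ (π : S → ℝ) (πl : ℝ → S → ℝ),
      (∀ t : ℝ≥0, JumpLR.IsInvariantDistribution
        (JumpLR.transitionMatrix (P 0) (X 0) t) π) →
      (∀ lam : ℝ, JumpLR.IsInvariantDistribution
        (JumpLR.transitionMatrix (P lam) (X lam) T.toNNReal) (πl lam)) →
      ∀ v : S → ℝ,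
        (∀ (lam : ℝ) (t : ℝ≥0),
          JumpLR.meanObservable (P lam) (X lam) (πl lam) v (t + T.toNNReal) =
            JumpLR.meanObservable (P lam) (X lam) (πl lam) v t) ∧
        (∀ lam : ℝ, IntervalIntegrable
          (fun t : ℝ => JumpLR.meanObservable (P lam) (X lam) (πl lam) v t.toNNReal)
          volume 0 T) ∧
        ∀ k : ℤ,
          IntegrableOn (JumpLR.semigroupPairing r g π T k v) (Set.Ioi 0) ∧
          IntegrableOn (JumpLR.correlation (P 0) (X 0) r g π T k v) (Set.Ioi 0) ∧
          HasDerivAt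
            (fun lam : ℝ => JumpLR.fourierCoefficient T k
              (fun t => JumpLR.meanObservable (P lam) (X lam) (πl lam) v t.toNNReal))
            (∫ s in Set.Ioi (0 : ℝ), JumpLR.semigroupPairing r g π T k v s) 0 ∧
          ∫ s in Set.Ioi (0 : ℝ), JumpLR.semigroupPairing r g π T k v s =
            ∫ s in Set.Ioi (0 : ℝ), JumpLR.correlation (P 0) (X 0) r g π T k v s := by
  classical
  obtain ⟨M, hM⟩ := hg_bdd
  obtain ⟨R, hR0, hR⟩ : ∃ R : ℝ, 0 ≤ R ∧ ∀ x y, r x y ≤ R := by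
    obtain ⟨w, hw⟩ := Finite.exists_max fun w : S × S => r w.1 w.2
    exact ⟨r w.1 w.2, hr _ _, fun x y => hw (x, y)⟩
  have hq := JumpLR.boundedRates_perturbedRate hr hR hg_meas hM
  have hC : ∀ lam : ℝ, 0 ≤ Real.exp (|lam| * M) * R := fun lam => by positivity
  have hp := fun lam => JumpLR.isTransitionFamily_transitionMatrix (hq lam) (hX lam)
  have hpos : ∀ lam t : ℝ, 0 < t → ∀ x y,
      0 < JumpLR.transitionMatrix (P lam) (X lam) t.toNNReal x y := fun lam t ht x y =>
    ((hp lam).isForwardSolution x).pos (hq lam) (hC lam) hirr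
      (fun s a b hab => mul_pos (Real.exp_pos _) hab) ht y
  have hq0 : JumpLR.BoundedRates (fun _ => r) R := ⟨fun _ _ => measurable_const,
    fun _ => hr, fun _ => hR⟩
  have hrate0 : JumpLR.perturbedRate r g 0 = fun _ => r :=
    funext fun s => JumpLR.perturbedRate_zero r g s
  have hX0 : ∀ x, JumpLR.IsMarkovJumpProcess (fun _ => r) x (P 0 x) (X 0) := fun x => by
    have h := hX 0 x
    rwa [hrate0] at h
  have hp0 := JumpLR.isTransitionFamily_transitionMatrix hq0 hX0
  have hπT : ∀ lam : ℝ, ∃! π : S → ℝ, JumpLR.IsInvariantDistribution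
      (JumpLR.transitionMatrix (P lam) (X lam) T.toNNReal) π := fun lam =>
    JumpLR.existsUnique_isInvariantDistribution ((hp lam).mem T) (hpos lam T hT)
  refine ⟨?_, hπT, ?_⟩
  · obtain ⟨π, hπ, huniq⟩ :=
      JumpLR.existsUnique_isInvariantDistribution (hp0.mem 1) (hpos 0 1 one_pos)
    refine ⟨π, fun t => ?_, fun π' hπ' => huniq π' (hπ' _)⟩
    simpa using hp0.isInvariantDistribution_of_one hq0 hR0 (hpos 0 1 one_pos) hπ
      (NNReal.coe_nonneg t)
  intro π πl hπ hπl v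
  -- The one-time laws of the oscillatory steady state, a forward solution which is `T`-periodic
  -- because `πl lam` is fixed over one period.
  set μ : ℝ → ℝ → S → ℝ := fun lam t =>
    Matrix.vecMul (πl lam) (JumpLR.transitionMatrix (P lam) (X lam) t.toNNReal) with hμdef
  have hμ : ∀ lam, JumpLR.IsForwardSolution (JumpLR.perturbedRate r g lam) (μ lam) := fun lam =>
    JumpLR.IsForwardSolution.mix (hq lam) (hC lam) (hp lam).isForwardSolution (hπl lam).1
  have hper : ∀ lam t, 0 ≤ t → μ lam (t + T) = μ lam t := fun lam t ht => by
    have h := (hp lam).vecMul_add (hq lam) (hC lam) hT.le (fun s => by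
      funext x y
      simp only [JumpLR.perturbedRate, hg_per x y s]) (hπl lam).1 ht
    rw [(hπl lam).2] at h
    exact h
  have hmean : ∀ (lam : ℝ) (t : ℝ≥0), JumpLR.meanObservable (P lam) (X lam) (πl lam) v t =
      ∑ y, μ lam t y * v y := fun lam t => by
    rw [JumpLR.meanObservable_eq (hX lam) (hπl lam).1.1]
    simp [hμdef]
  have hmean' : ∀ lam t : ℝ, 0 ≤ t →
      JumpLR.meanObservable (P lam) (X lam) (πl lam) v t.toNNReal = ∑ y, μ lam t y * v y :=
    fun lam t ht => by rw [hmean, Real.coe_toNNReal t ht]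
  refine ⟨fun lam t => ?_, fun lam => ?_, fun k => ?_⟩
  · rw [hmean, hmean, NNReal.coe_add, Real.coe_toNNReal T hT.le, hper lam t t.2]
  · have h : IntervalIntegrable (fun t => ∑ y, μ lam t y * v y) volume 0 T :=
      JumpLR.intervalIntegrable_finsetSum fun y =>
        (JumpLR.intervalIntegrable_of_measurable_of_bounded
          ((hμ lam).measurable y).aestronglyMeasurable
          (fun t => JumpLR.abs_le_one_of_mem_stdSimplex ((hμ lam).mem t) y) _ _).mul_const _
    refine h.congr fun t ht => ?_
    rw [Set.uIoc_of_le hT.le] at ht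
    exact (hmean' lam t ht.1.le).symm
  -- `π` is its own image at time `1`, and every law at a positive time charges all states.
  have hπpos : ∀ x, 0 < π x := fun x => by
    have h := (JumpLR.IsForwardSolution.mix hq0 hR0 hp0.isForwardSolution (hπ 1).1).pos hq0 hR0
      hirr (fun _ _ _ h => h) one_pos x
    simpa only [(hπ (Real.toNNReal 1)).2] using h
  obtain ⟨K, c, hK, hc, hdec⟩ := hp0.exists_semigroupDecay hq0 hR0 hirr (hπ (Real.toNNReal 1))
  have hz := JumpLR.fourierExponent_re T k
  obtain ⟨hint, hval⟩ := JumpLR.integral_sum_mul_exp_mul hc hdec hz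
    (fun x => π x * JumpLR.psiHat r g π T k x) (fun x => (v x : ℂ))
  -- Both integrands agree pointwise on `(0, ∞)` with one sum over the centred semigroup, so
  -- integrability and the equality of the two integrals come together.
  have hpair : Set.EqOn (JumpLR.semigroupPairing r g π T k v) _ (Set.Ioi 0) := fun s hs =>
    JumpLR.semigroupPairing_eq hq0 hR0 hp0 hπpos hg_meas hM v (le_of_lt hs)
  have hcorr : Set.EqOn (JumpLR.correlation (P 0) (X 0) r g π T k v) _ (Set.Ioi 0) := fun s hs =>
    JumpLR.correlation_eq hq0 hR0 hX0 hπpos hg_meas hM v (le_of_lt hs)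
  refine ⟨hint.congr_fun hpair.symm measurableSet_Ioi, hint.congr_fun hcorr.symm measurableSet_Ioi,
    ?_, ?_⟩
  · rw [setIntegral_congr_fun measurableSet_Ioi hpair, hval,
      JumpLR.sum_mul_psiHat_mul hπpos hg_meas hM]
    have hderiv := (JumpLR.hasDerivAt_integral_exp_mul hK hc hdec hr hR0 hR hg_meas hM hμ hT hper
      hz (JumpLR.exp_fourierExponent_mul hT k) (fun x => (v x : ℂ))).const_mul (1 / (T : ℂ))
    refine hderiv.congr_of_eventuallyEq (Eventually.of_forall fun lam => ?_)
    simp only [JumpLR.fourierCoefficient]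
    congr 1
    refine intervalIntegral.integral_congr fun t ht => ?_
    rw [Set.uIcc_of_le hT.le] at ht
    simp only [hmean' lam t ht.1, JumpLR.fourierExponent, Complex.real_smul]
    push_cast
    rfl
  · rw [setIntegral_congr_fun measurableSet_Ioi hpair, setIntegral_congr_fun measurableSet_Ioi hcorr]
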